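/- **Definitions.** A *continuum* is a nonempty compact connected metrizable space. A *dendroid* is an arcwise connected continuum $F$ that is hereditarily unicoherent (whenever a subcontinuum of $F$ is the union of two subcontinua, their intersection is connected). In a dendroid, $[x,y]$ denotes the unique arc with endpoints $x\neq y$, and $[x,x]=\{x\}$. $E(F)$ is the set of *endpoints* of $F$: the points that are an endpoint of every arc of $F$ containing them. A *fan* is a dendroid with exactly one point $t$ (its *top*) that is the top of a simple triod contained in $F$; its *blades* are the arcs $[t,e]$, $e\in E(F)$. A fan is *smooth* if $x_n\to x$ implies $[t,x_n]\to[t,x]$ in the Hausdorff metric, and *endpoint-homogeneous* if for all $e,e'\in E(F)$ there is a homeomorphism $h:F\to F$ with $h(e)=e'$. For $X\subseteq[0,1]$, a fan $F$ is *$X$-EPG* if for every blade $B$ there is a homeomorphism $\phi:[0,1]\to B$ with $\phi(0)=t$ and $\phi[X]=B\cap\overline{E(F)\setminus B}$. Subsets $X,Y\subseteq[0,1]$ are *equivalently embedded* if some order-preserving homeomorphism of $[0,1]$ onto itself maps $X$ onto $Y$. **Theorem.** There are uncountably many homeomorphism types of endpoint-homogeneous smooth fans. More precisely, let $\mathbb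 N=\{1,2,\dots\}$, let $a_n,b_n$ be any real numbers with $\frac1{n+1}<a_n<b_n<\frac1n$ for $n\in\mathbb N$, and for $A\subseteq\mathbb N$ put $$X_A=\{0\}\cup\{\tfrac1n:n\in\mathbb N\}\cup\bigcup_{n\in A}[a_n,b_n],\qquad Y_A=X_A\setminus\{1\},\qquad M_A=\max Y_A<1 .$$ Then: 1. If $A\neq A'$, then $X_A$ and $X_{A'}$ are not equivalently embedded. 2. For every $A$ there is a sequence $y=(y_n)_{n\in\mathbb N}$ in $Y_A\setminus\{0\}$ whose set of values is dense in $Y_A\setminus\{0\}$ and which takes each of its values infinitely often. Call such a sequence *$A$-admissible*. 3. For every $A$ and every $A$-admissible $y$, let $C\subseteq[0,1]^2$ be the union of $[0,1]\times\{0\}$, of $\{0\}\times[0,1]$, and, over all $k\ge1$ and $(n_1,\dots,n_k)\in\mathbb N^k$, of the sets $$\Big\{2\sum_{i=1}^k 3^{-(n_1+\dots+n_i)}\Big\}\times\Big[0,\ M_A^{\,n_1+\dots+n_{k-1}}\prod_{i=1}^k y_{n_i}\Big].$$ Let $F_C$ be obtained from $C$ by collapsing $[0,1]\times\{0\}$ to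 a point $t_0$ (equivalently, $F_C$ is the one-point compactification of $\{(u,v)\in C: v>0\}$), and let $F_{A,y}$ be obtained from $F_C\times K$, $K$ the Cantor set, by collapsing $\{t_0\}\times K$ to a point (equivalently, $F_{A,y}$ is the one-point compactification of $(F_C\setminus\{t_0\})\times K$). Then $F_{A,y}$ is an endpoint-homogeneous smooth fan, and for every $X\subseteq[0,1]$, $F_{A,y}$ is $X$-EPG if and only if $X$ is equivalently embedded with $X_A$ (that is, the invariant $EPG(F_{A,y})$ is the class of $X_A$). 4. If $A\neq A'$, $y$ is $A$-admissible and $y'$ is $A'$-admissible, then $F_{A,y}$ and $F_{A',y'}$ are not homeomorphic. -/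

import Mathlib

open Set Filter Topology TopologicalSpace unitInterval

/-! ## Continua, dendroids and fans -/

section Fans

variable (F : Type*) [TopologicalSpace F]

/-- A continuum: a nonempty compact connected metrizable space. -/
def IsContinuum : Prop :=
  CompactSpace F ∧ ConnectedSpace F ∧ MetrizableSpace F

variable {F}

/-- A subcontinuum of a continuum: a subset which is nonempty, compact and connected. -/
def IsSubcontinuum (S : Set F) : Prop :=
  IsCompact S ∧ IsConnected S

/-- A subcontinuum `S` is unicoherent if, whenever it is the union of two subcontinua,
their intersection is connected. -/
def IsUnicoherent (S : Set F) : Prop :=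
  ∀ A B : Set F, IsSubcontinuum A → IsSubcontinuum B → A ∪ B = S → IsConnected (A ∩ B)

/-- An arc: a subset homeomorphic to the unit interval. -/
def IsArc (A : Set F) : Prop :=
  Nonempty (A ≃ₜ I)

/-- `a` is an endpoint of the arc `A`: removing it leaves a connected set. -/
def IsArcEndpoint (A : Set F) (a : F) : Prop :=
  a ∈ A ∧ IsConnected (A \ {a})

/-- `S = [x, y]`: an arc with endpoints `x` and `y` if `x ≠ y` (in a dendroid there is exactly
one), and the singleton `{x}` if `x = y`. -/
def IsSegment (x y : F) (S : Set F) : Prop :=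
  (x = y ∧ S = {x}) ∨ (x ≠ y ∧ IsArc S ∧ IsArcEndpoint S x ∧ IsArcEndpoint S y)

variable (F)

/-- A dendroid: an arcwise connected, hereditarily unicoherent continuum. -/
def IsDendroid : Prop :=
  IsContinuum F ∧
  (∀ x y : F, ∃ S : Set F, IsSegment x y S) ∧
  (∀ S : Set F, IsSubcontinuum S → IsUnicoherent S)

/-- The set `E(F)` of endpoints of `F`: points that are an endpoint of every arc of `F`
that contains them. -/
def endpoints : Set F :=
  {x | ∀ A : Set F, IsArc A → x ∈ A → IsArcEndpoint A x}

/-- The model simple triod `([-1,1] × {0}) ∪ ({0} × [0,1])` in the plane, with top `(0, 0)`. -/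
def modelTriod : Set (ℝ × ℝ) :=
  (Icc (-1) 1 ×ˢ {0}) ∪ ({0} ×ˢ Icc 0 1)

variable {F}

/-- A ramification point: the top of a simple triod contained in `F`. -/
def IsRamificationPoint (x : F) : Prop :=
  ∃ (T : Set F) (e : T ≃ₜ modelTriod) (hx : x ∈ T), (e ⟨x, hx⟩ : ℝ × ℝ) = (0, 0)

variable (F)

/-- A fan: a dendroid with exactly one ramification point (its top). -/
def IsFan : Prop :=
  IsDendroid F ∧ ∃! t : F, IsRamificationPoint t

/-- A fan with top `t` is smooth if `x n → x` implies `[t, x n] → [t, x]` in the Hausdorff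
metric. (The topology of `NonemptyCompacts F` is the Vietoris topology, which on the nonempty
compact subsets of a metric space is the topology of the Hausdorff metric.) -/
def IsSmoothFan : Prop :=
  IsFan F ∧ ∀ t : F, IsRamificationPoint t →
    ∀ (x : ℕ → F) (x₀ : F) (S : ℕ → NonemptyCompacts F) (S₀ : NonemptyCompacts F),
      (∀ n, IsSegment t (x n) (S n : Set F)) → IsSegment t x₀ (S₀ : Set F) →
      Tendsto x atTop (𝓝 x₀) → Tendsto S atTop (𝓝 S₀)

/-- Any endpoint can be moved to any other one by a self-homeomorphism. -/
def IsEndpointHomogeneous : Prop :=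
  ∀ e ∈ endpoints F, ∀ e' ∈ endpoints F, ∃ h : F ≃ₜ F, h e = e'

variable {F}

/-- The blades of a fan with top `t`: the arcs `[t, e]` with `e` an endpoint. -/
def blades (t : F) : Set (Set F) :=
  {B | ∃ e ∈ endpoints F, IsSegment t e B}

variable (F)

/-- `F` is an `X`-endpoint generated fan. -/
def IsEPG (X : Set I) : Prop :=
  IsFan F ∧ ∀ t : F, IsRamificationPoint t → ∀ B ∈ blades t,
    ∃ φ : I ≃ₜ B, (φ 0 : F) = t ∧
      (fun s => (φ s : F)) '' X = B ∩ closure (endpoints F \ B)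

end Fans

/-- Subsets of `[0,1]` are equivalently embedded if an order-preserving self-homeomorphism of
`[0,1]` maps one onto the other. -/
def EquivalentlyEmbedded (X Y : Set I) : Prop :=
  ∃ h : I ≃ₜ I, StrictMono h ∧ h '' X = Y

/-! ## Homeomorphism types -/

/-- The type of all endpoint-homogeneous smooth fans. -/
def EHSmoothFan : Type 1 :=
  {F : TopCat.{0} // IsSmoothFan F ∧ IsEndpointHomogeneous F}

/-- The relation of being homeomorphic, on endpoint-homogeneous smooth fans. -/
def homeomorphismSetoid : Setoid EHSmoothFan where
  r F G := Nonempty (F.1 ≃ₜ G.1)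
  iseqv :=
    { refl := fun F => ⟨Homeomorph.refl F.1⟩
      symm := fun ⟨h⟩ => ⟨h.symm⟩
      trans := fun ⟨h⟩ ⟨k⟩ => ⟨h.trans k⟩ }

/-! ## The sets `X_A` and the comb construction -/

/-- `X_A = {0} ∪ {1/n : n ≥ 1} ∪ ⋃_{n ∈ A} [a_n, b_n]`. -/
def setX (a b : ℕ+ → ℝ) (A : Set ℕ+) : Set I :=
  {s | (s : ℝ) = 0 ∨ (∃ n : ℕ+, (s : ℝ) = 1 / (n : ℝ)) ∨ ∃ n ∈ A, (s : ℝ) ∈ Icc (a n) (b n)}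

/-- A sequence enumerating, with infinitely many repetitions of each value, a dense subset of
`Y \ {0}`. -/
def IsCombSequence (Y : Set I) (y : ℕ+ → I) : Prop :=
  (∀ n, y n ∈ Y \ {0}) ∧ Y \ {0} ⊆ closure (range y) ∧ ∀ n, {m | y m = y n}.Infinite

/-- The horizontal coordinate `2 ∑_{i ≤ k} 3^{-(n_1 + ⋯ + n_i)}` of the tooth with index
`(n_1, …, n_k)` (here the tuple has length `k + 1 ≥ 1`). -/
noncomputable def toothPos {k : ℕ} (n : Fin (k + 1) → ℕ+) : ℝ :=
  2 * ∑ i, (1 / 3 : ℝ) ^ (∑ j ∈ Finset.Iic i, (n j : ℕ))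

/-- The height `M^{n_1 + ⋯ + n_{k-1}} y_{n_1} ⋯ y_{n_k}` of the tooth with index
`(n_1, …, n_k)` (here the tuple has length `k + 1 ≥ 1`). -/
noncomputable def toothHeight (M : ℝ) (y : ℕ+ → I) {k : ℕ} (n : Fin (k + 1) → ℕ+) : ℝ :=
  M ^ (∑ i : Fin k, (n i.castSucc : ℕ)) * ∏ i, (y (n i) : ℝ)

/-- The comb: the base `[0,1] × {0}`, the tooth `{0} × [0,1]`, and one tooth for each nonempty
tuple of positive integers. -/
noncomputable def comb (M : ℝ) (y : ℕ+ → I) : Set (ℝ × ℝ) :=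
  (Icc 0 1 ×ˢ {0}) ∪ ({0} ×ˢ Icc 0 1) ∪
    ⋃ (k : ℕ) (n : Fin (k + 1) → ℕ+), {toothPos n} ×ˢ Icc 0 (toothHeight M y n)

/-- The fan of a comb `C`: the base of `C` is collapsed to a point. As `C` is compact this is the
one-point compactification of the part of `C` above the base; the top is `∞`. -/
abbrev CombFan (C : Set (ℝ × ℝ)) : Type :=
  OnePoint {z : ℝ × ℝ // z ∈ C ∧ 0 < z.2}

/-- The product of a space `F` with the Cantor set, with `{t} × cantorSet` collapsed to a point;
as `F` is compact, this is the one-point compactification of `(F \ {t}) × cantorSet`. -/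
abbrev CantorMultiple (F : Type) [TopologicalSpace F] (t : F) : Type :=
  OnePoint ({x : F // x ≠ t} × cantorSet)

/-- The fan attached to a closed set `X ⊆ [0,1]` with `0, 1 ∈ X` and `1` isolated in `X`, and to a
sequence `y` in `Y = X \ {1}`: first the fan of the comb with parameters `M = max Y` and `y`, then
its Cantor multiple. -/
abbrev FanOf (X : Set I) (y : ℕ+ → I) : Type :=
  CantorMultiple (CombFan (comb (sSup ((fun s : I => (s : ℝ)) '' (X \ {1}))) y)) OnePoint.infty

/-! ## Arcs -/

section Arcs

variable {F G : Type*} [TopologicalSpace F] [TopologicalSpace G]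

/-! Fans are handled through two functions: a height vanishing only at the top, and a fibre map into
a totally separated space, continuous off the top (`FanModel`). They define an order with least
element `top`. Closed connected sets are order-convex (`mem_of_le_of_le`). Conversely, a convex set
in which any two points are comparable, unless it contains the top, is connected
(`isPreconnected_of_convex`). Hence hereditary unicoherence, uniqueness of `[top, x]`, the
description of endpoints as maximal elements, and uniqueness of the ramification point. Smoothness
comes from compactness and the closedness of the order.

The comb is self-similar. For each `m`, `contract` embeds the comb without its base onto its clopen
part over `[2·3^(-m), 3·3^(-m)]`, carrying the tooth over `0` to the tooth `(m)` and the tooth `n`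
to the tooth `(m, n)`. In the product with the Cantor set, a clopen slab and the contracted copy of
it can be placed over disjoint clopen sets of Cantor coordinates, and then swapped by a
homeomorphism (`movable_contractTeeth`). By induction on tuples every tip is equivalent to the tip
`(0, 1)`, which gives endpoint-homogeneity.

By homogeneity the trace need only be computed on one blade over `0` (`isBladeTrace_baseTip`). There
the one-index teeth accumulate at the closure of the values of `y`. The tooth of a longer tuple
starting with `n₁` has height at most `M ^ n₁`, so such teeth contribute only the top. The endpoint
itself is a limit of tips in other Cantor copies. The trace is therefore `X_A`.

Finally, the isolated points of `X_A` are exactly the `1/n`. An increasing homeomorphism between two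
such sets fixes each of them, so it detects which gaps contain an interval. The trace is a
topological invariant, so distinct `A` give non-homeomorphic fans, and there are uncountably many
`A`. -/

theorem exists_homeomorph_of_injOn [T2Space G] {K : Set F} {M : Set G} (hK : IsCompact K)
    (f : F → G) (hf : ContinuousOn f K) (hi : InjOn f K) (hM : f '' K = M) :
    ∃ e : K ≃ₜ M, ∀ w : K, (e w : G) = f w := by
  have := isCompact_iff_compactSpace.mp hK
  let e : K ≃ M := BijOn.equiv f ⟨by rw [← hM]; exact mapsTo_image f K, hi, hM.ge⟩
  have he : Continuous e := by
    refine Continuous.subtype_mk (continuousOn_iff_continuous_domRestrict.mp hf) _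
  exact ⟨he.homeoOfEquivCompactToT2, fun w => rfl⟩

theorem isConnected_diff_singleton_iff_compl (C : Set F) (y : C) :
    IsConnected (C \ {(y : F)}) ↔ IsConnected ({y}ᶜ : Set C) := by
  have : C \ {(y : F)} = Subtype.val '' ({y}ᶜ : Set C) := by
    ext z
    simp
  rw [this, IsConnected, IsConnected, image_nonempty,
    IsInducing.subtypeVal.isPreconnected_image]

theorem isConnected_diff_singleton_iff {A : Set F} {B : Set G} (e : A ≃ₜ B) (x : A) :
    IsConnected (A \ {(x : F)}) ↔ IsConnected (B \ {(e x : G)}) := by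
  rw [isConnected_diff_singleton_iff_compl, isConnected_diff_singleton_iff_compl,
    ← e.isConnected_image, image_compl_eq e.bijective, image_singleton]

theorem isArcEndpoint_iff_of_homeomorph {A : Set F} {B : Set G} (e : A ≃ₜ B) (x : A) :
    IsArcEndpoint A (x : F) ↔ IsArcEndpoint B (e x : G) := by
  simp [IsArcEndpoint, isConnected_diff_singleton_iff e x]

theorem isConnected_Icc_diff_singleton_iff {a b c : ℝ} (hab : a < b) (hc : c ∈ Icc a b) :
    IsConnected (Icc a b \ {c}) ↔ c = a ∨ c = b := by
  constructor
  · intro h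
    by_contra! hn
    have := isPreconnected_iff_ordConnected.mp h.isPreconnected
    have h2 := this.out (x := a) (y := b) ⟨⟨le_rfl, hab.le⟩, fun h => hn.1 h.symm⟩
      ⟨⟨hab.le, le_rfl⟩, fun h => hn.2 h.symm⟩ hc
    exact h2.2 rfl
  · rintro (rfl | rfl)
    · rw [Icc_sdiff_left]
      exact isConnected_Ioc hab
    · rw [Icc_sdiff_right]
      exact isConnected_Ico hab

theorem isArc_of_image_eq_Icc {K : Set F} {a b : ℝ} (hab : a < b) (hK : IsCompact K)
    (f : F → ℝ) (hf : ContinuousOn f K) (hi : InjOn f K) (hM : f '' K = Icc a b) :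
    IsArc K ∧ ∀ x ∈ K, IsArcEndpoint K x ↔ f x = a ∨ f x = b := by
  obtain ⟨e, he⟩ := exists_homeomorph_of_injOn hK f hf hi hM
  refine ⟨⟨e.trans (iccHomeoI a b hab)⟩, fun x hx => ?_⟩
  rw [isArcEndpoint_iff_of_homeomorph e ⟨x, hx⟩, IsArcEndpoint, he]
  have hx' : f x ∈ Icc a b := hM ▸ mem_image_of_mem f hx
  simp only [hx', true_and, isConnected_Icc_diff_singleton_iff hab hx']

theorem isArcEndpoint_iff {A : Set F} (φ : A ≃ₜ I) (x : A) :
    IsArcEndpoint A (x : F) ↔ φ x = 0 ∨ φ x = 1 := by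
  rw [isArcEndpoint_iff_of_homeomorph φ x, IsArcEndpoint,
    isConnected_Icc_diff_singleton_iff zero_lt_one (φ x).2]
  rw [Subtype.ext_iff, Subtype.ext_iff]
  exact and_iff_right (φ x).2

theorem IsArc.isCompact {A : Set F} (hA : IsArc A) : IsCompact A := by
  obtain ⟨φ⟩ := hA
  have : CompactSpace A := φ.symm.compactSpace
  exact isCompact_iff_compactSpace.mpr this

theorem IsArc.isConnected {A : Set F} (hA : IsArc A) : IsConnected A := by
  obtain ⟨φ⟩ := hA
  have := φ.symm.surjective.connectedSpace φ.symm.continuous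
  exact isConnected_iff_connectedSpace.mpr this

theorem IsArc.nontrivial {A : Set F} (hA : IsArc A) : A.Nontrivial := by
  obtain ⟨φ⟩ := hA
  refine ⟨φ.symm 0, (φ.symm 0).2, φ.symm 1, (φ.symm 1).2, fun h => ?_⟩
  have := φ.symm.injective (Subtype.ext h)
  simp at this

/-- A connected subset of an arc containing both endpoints is the whole arc. -/
theorem IsArc.eq_of_isPreconnected {A D : Set F} {x y : F} (hA : IsArc A) (hxy : x ≠ y)
    (hx : IsArcEndpoint A x) (hy : IsArcEndpoint A y) (hD : IsPreconnected D) (hDA : D ⊆ A)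
    (hxD : x ∈ D) (hyD : y ∈ D) : D = A := by
  obtain ⟨φ⟩ := hA
  refine hDA.antisymm fun z hz => ?_
  have hpre : IsPreconnected (φ '' (Subtype.val ⁻¹' D)) := by
    refine IsPreconnected.image ?_ _ φ.continuous.continuousOn
    rw [← IsInducing.subtypeVal.isPreconnected_image, Subtype.image_preimage_coe,
      inter_eq_self_of_subset_right hDA]
    exact hD
  have hord := isPreconnected_iff_ordConnected.mp hpre
  have h1 := (isArcEndpoint_iff φ ⟨x, hx.1⟩).mp hx
  have h2 := (isArcEndpoint_iff φ ⟨y, hy.1⟩).mp hy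
  have h3 : φ ⟨x, hx.1⟩ ≠ φ ⟨y, hy.1⟩ := fun h => hxy (congrArg Subtype.val (φ.injective h))
  have h0 : (0 : I) ∈ φ '' (Subtype.val ⁻¹' D) ∧ (1 : I) ∈ φ '' (Subtype.val ⁻¹' D) := by
    rcases h1 with h1 | h1 <;> rcases h2 with h2 | h2
    · exact absurd (h1.trans h2.symm) h3
    · exact ⟨⟨_, hxD, h1⟩, ⟨_, hyD, h2⟩⟩
    · exact ⟨⟨_, hyD, h2⟩, ⟨_, hxD, h1⟩⟩
    · exact absurd (h1.trans h2.symm) h3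
  obtain ⟨w, hw, hw'⟩ := hord.out h0.1 h0.2 ⟨(φ ⟨z, hz⟩).2.1, (φ ⟨z, hz⟩).2.2⟩
  have := φ.injective hw'
  subst this
  exact hw

end Arcs

/-! ## Fans presented by a height function and a fibre map -/

/-- A presentation of a space as a fan of vertical segments issuing from `top`: away from `top` a
point is determined by its fibre and its height, and every fibre is closed downwards. -/
structure FanModel (F Z : Type*) [TopologicalSpace F] [TopologicalSpace Z] where
  top : F
  height : F → ℝ
  fibre : F → Z
  continuous_height : Continuous height
  height_nonneg : ∀ x, 0 ≤ height x
  height_eq_zero : ∀ x, height x = 0 ↔ x = top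
  continuousOn_fibre : ContinuousOn fibre {top}ᶜ
  ext : ∀ x y, x ≠ top → y ≠ top → fibre x = fibre y → height x = height y → x = y
  exists_of_le : ∀ x s, 0 < s → s ≤ height x → ∃ y, fibre y = fibre x ∧ height y = s
  exists_three : ∃ x y z, x ≠ top ∧ y ≠ top ∧ z ≠ top ∧ fibre x ≠ fibre y ∧ fibre x ≠ fibre z ∧
    fibre y ≠ fibre z

namespace FanModel

variable {F Z : Type*} [TopologicalSpace F] [TopologicalSpace Z] (D : FanModel F Z)

/-- The order of a fan, with `top` as the least element. -/
def le (x y : F) : Prop := x = D.top ∨ (D.fibre x = D.fibre y ∧ D.height x ≤ D.height y)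

/-- The order interval between `x` and `y`. -/
def seg (x y : F) : Set F := {w | D.le x w ∧ D.le w y}

variable {D}

theorem height_pos {x : F} : 0 < D.height x ↔ x ≠ D.top := by
  rw [← not_iff_not, not_lt, not_not, ← D.height_eq_zero]
  exact ⟨fun h => h.antisymm (D.height_nonneg x), fun h => h.le⟩

theorem height_top : D.height D.top = 0 := (D.height_eq_zero _).mpr rfl

theorem le_refl (x : F) : D.le x x := Or.inr ⟨rfl, _root_.le_refl _⟩

theorem top_le (x : F) : D.le D.top x := Or.inl rfl

theorem le.height_le {x y : F} (h : D.le x y) : D.height x ≤ D.height y := by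
  rcases h with rfl | h
  · rw [height_top]; exact D.height_nonneg y
  · exact h.2

theorem le.fibre_eq {x y : F} (h : D.le x y) (hx : x ≠ D.top) : D.fibre x = D.fibre y :=
  (h.resolve_left hx).1

theorem le.ne_top {x y : F} (h : D.le x y) (hx : x ≠ D.top) : y ≠ D.top :=
  height_pos.mp ((height_pos.mpr hx).trans_le h.height_le)

theorem le.trans {x y z : F} (h : D.le x y) (h' : D.le y z) : D.le x z := by
  by_cases hx : x = D.top
  · exact Or.inl hx
  · exact Or.inr ⟨(h.fibre_eq hx).trans (h'.fibre_eq (h.ne_top hx)), h.height_le.trans h'.height_le⟩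

theorem le.eq_of_height {x y : F} (h : D.le x y) (h' : D.height y ≤ D.height x) : x = y := by
  by_cases hx : x = D.top
  · rw [hx]
    rw [hx, height_top] at h'
    exact ((D.height_eq_zero y).mp (h'.antisymm (D.height_nonneg y))).symm
  · exact D.ext x y hx (h.ne_top hx) (h.fibre_eq hx) (h.height_le.antisymm h')

theorem le.antisymm {x y : F} (h : D.le x y) (h' : D.le y x) : x = y :=
  h.eq_of_height h'.height_le

theorem le_of_le_of_le {x y z : F} (hx : D.le x z) (hy : D.le y z)
    (h : D.height x ≤ D.height y) : D.le x y := by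
  by_cases hx0 : x = D.top
  · exact Or.inl hx0
  · have hy0 : y ≠ D.top := height_pos.mp ((height_pos.mpr hx0).trans_le h)
    exact Or.inr ⟨(hx.fibre_eq hx0).trans (hy.fibre_eq hy0).symm, h⟩

theorem le_total_of_fibre {x y : F} (h : D.fibre x = D.fibre y) : D.le x y ∨ D.le y x :=
  (le_total (D.height x) (D.height y)).imp (fun h' => Or.inr ⟨h, h'⟩) fun h' => Or.inr ⟨h.symm, h'⟩

theorem exists_le_height {x : F} {s : ℝ} (h0 : 0 ≤ s) (h1 : s ≤ D.height x) :
    ∃ y, D.le y x ∧ D.height y = s := by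
  rcases h0.eq_or_lt with rfl | h0
  · exact ⟨D.top, Or.inl rfl, height_top⟩
  · obtain ⟨y, hy, hy'⟩ := D.exists_of_le x s h0 h1
    exact ⟨y, Or.inr ⟨hy, hy' ▸ h1⟩, hy'⟩

theorem isOpen_compl_top [T1Space F] : IsOpen ({D.top}ᶜ : Set F) := isOpen_compl_singleton

theorem isClosed_height_ge (c : ℝ) : IsClosed {x | c ≤ D.height x} :=
  isClosed_le continuous_const D.continuous_height

/-- The relation fails either because the height drops, or because both points are off `top` with
different fibres. Both conditions are open, and the second uses the fibre map only where it is
continuous. -/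
theorem isClosed_le [T2Space F] [T2Space Z] : IsClosed {p : F × F | D.le p.1 p.2} := by
  have h1 : {p : F × F | D.le p.1 p.2}ᶜ =
      {p | D.height p.2 < D.height p.1} ∪
      (({D.top}ᶜ ×ˢ {D.top}ᶜ) ∩ (fun p : F × F => (D.fibre p.1, D.fibre p.2)) ⁻¹' (diagonal Z)ᶜ) := by
    ext ⟨x, y⟩
    simp only [mem_compl_iff, mem_ofPred_eq, mem_union, mem_inter_iff, mem_prod, mem_singleton_iff,
      mem_preimage, mem_diagonal_iff]
    constructor
    · intro h
      by_cases hxy : D.height y < D.height x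
      · exact Or.inl hxy
      · have hx : x ≠ D.top := fun hx => h (Or.inl hx)
        have hy : y ≠ D.top := height_pos.mp ((height_pos.mpr hx).trans_le (not_lt.mp hxy))
        exact Or.inr ⟨⟨hx, hy⟩, fun h' => h (Or.inr ⟨h', not_lt.mp hxy⟩)⟩
    · rintro (h | ⟨⟨hx, hy⟩, h⟩) h'
      · exact absurd h'.height_le (not_le.mpr h)
      · exact h (h'.fibre_eq hx)
  rw [← isOpen_compl_iff, h1]
  refine (isOpen_lt (D.continuous_height.comp continuous_snd)
    (D.continuous_height.comp continuous_fst)).union ?_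
  refine ContinuousOn.isOpen_inter_preimage ?_ (isOpen_compl_top.prod isOpen_compl_top)
    isClosed_diagonal.isOpen_compl
  exact (D.continuousOn_fibre.comp continuousOn_fst fun p hp => hp.1).prodMk
    (D.continuousOn_fibre.comp continuousOn_snd fun p hp => hp.2)

theorem isClosed_seg [T2Space F] [T2Space Z] (x y : F) : IsClosed (D.seg x y) :=
  (isClosed_le.preimage (by fun_prop : Continuous fun w => (x, w))).inter
    (isClosed_le.preimage (by fun_prop : Continuous fun w => (w, y)))

theorem injOn_height_seg (x y : F) : InjOn D.height (D.seg x y) := by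
  intro w hw w' hw' h
  exact (le_of_le_of_le hw.2 hw'.2 h.le).eq_of_height h.ge

theorem image_height_seg {x y : F} (h : D.le x y) :
    D.height '' D.seg x y = Icc (D.height x) (D.height y) := by
  ext s
  constructor
  · rintro ⟨w, hw, rfl⟩
    exact ⟨hw.1.height_le, hw.2.height_le⟩
  · rintro ⟨h1, h2⟩
    obtain ⟨w, hw, rfl⟩ := exists_le_height ((D.height_nonneg x).trans h1) h2
    exact ⟨w, ⟨le_of_le_of_le h hw h1, hw⟩, rfl⟩

theorem isPreconnected_seg [CompactSpace F] [T2Space F] [T2Space Z] {x y : F} (h : D.le x y) :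
    IsPreconnected (D.seg x y) := by
  obtain ⟨e, -⟩ := exists_homeomorph_of_injOn (isClosed_seg x y).isCompact D.height
    D.continuous_height.continuousOn (injOn_height_seg x y) (image_height_seg h)
  have : PreconnectedSpace (Icc (D.height x) (D.height y)) :=
    isPreconnected_iff_preconnectedSpace.mp isPreconnected_Icc
  have hr := isPreconnected_range (continuous_subtype_val.comp e.symm.continuous)
  rwa [e.symm.surjective.range_comp, Subtype.range_val] at hr

theorem exists_clopen_of_isCompact [TotallySeparatedSpace Z] {K : Set Z} (hK : IsCompact K) {z : Z}
    (hz : z ∉ K) : ∃ W : Set Z, IsClopen W ∧ z ∈ W ∧ Disjoint W K := by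
  have h : ∀ k : Z, k ∈ K → ∃ U : Set Z, IsClopen U ∧ z ∈ U ∧ k ∈ Uᶜ := fun k hk =>
    exists_isClopen_of_totally_separated (fun h => hz (h ▸ hk))
  choose! U hU hzU hkU using h
  obtain ⟨t, ht, htK⟩ := hK.elim_nhds_subcover (fun k => (U k)ᶜ)
    (fun k hk => (hU k hk).compl.isOpen.mem_nhds (hkU k hk))
  refine ⟨⋂ k ∈ t, U k, isClopen_biInter_finset fun k hk => hU k (ht k hk),
    mem_iInter₂.mpr fun k hk => hzU k (ht k hk), ?_⟩
  rw [disjoint_left]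
  intro w hw hwK
  obtain ⟨k, hk, hk'⟩ := mem_iUnion₂.mp (htK hwK)
  exact hk' (mem_iInter₂.mp hw k hk)

/-- Closed connected sets are order-convex. -/
theorem mem_of_le_of_le [CompactSpace F] [T2Space F] [TotallySeparatedSpace Z] {S : Set F}
    (hS : IsClosed S) (hS' : IsPreconnected S) {x y w : F} (hx : x ∈ S) (hy : y ∈ S)
    (hxw : D.le x w) (hwy : D.le w y) : w ∈ S := by
  by_contra hw
  have hwt : w ≠ D.top := by
    rintro rfl
    rcases hxw with rfl | hxw
    · exact hw hx
    · exact hw ((D.height_eq_zero x).mp ((height_top (D := D) ▸ hxw.2).antisymm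
        (D.height_nonneg x)) ▸ hx)
  have hyt := hwy.ne_top hwt
  have hpos := height_pos.mpr hwt
  -- `K` is the slice of `S` at the height of `w`. As `w ∉ S`, the fibre of `w` and `y` is missed by
  -- the compact image of `K`, so a clopen `W` separates it from that image.
  let K : Set F := S ∩ {u | D.height u = D.height w}
  have hK : IsCompact K :=
    (hS.inter (isClosed_eq D.continuous_height continuous_const)).isCompact
  have hKt : K ⊆ {D.top}ᶜ := by
    intro u hu
    exact height_pos.mp (hu.2.symm ▸ hpos : 0 < D.height u)
  have hyK : D.fibre y ∉ D.fibre '' K := by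
    rintro ⟨u, hu, huy⟩
    exact hw (D.ext u w (hKt hu) hwt (huy.trans (hwy.fibre_eq hwt).symm) hu.2 ▸ hu.1)
  obtain ⟨W, hW, hyW, hWK⟩ := exists_clopen_of_isCompact
    (hK.image_of_continuousOn (D.continuousOn_fibre.mono hKt)) hyK
  -- `U` is open, `V` is closed, and they differ only at the height of `w`, where `S` has no point
  -- with fibre in `W`. So they have the same trace on `S`, which contains `y` but not `x`.
  let U : Set F := ({D.top}ᶜ ∩ D.fibre ⁻¹' W) ∩ {u | D.height w < D.height u}
  let V : Set F := {u | D.height w ≤ D.height u} ∩ D.fibre ⁻¹' W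
  have hUo : IsOpen U := (D.continuousOn_fibre.isOpen_inter_preimage isOpen_compl_top hW.isOpen).inter
    (isOpen_lt continuous_const D.continuous_height)
  have hVc : IsClosed V := by
    refine ContinuousOn.preimage_isClosed_of_isClosed (D.continuousOn_fibre.mono ?_)
      (isClosed_height_ge _) hW.isClosed
    intro u hu
    exact height_pos.mp (hpos.trans_le hu)
  have hcov : S ⊆ U ∪ Vᶜ := by
    intro u hu
    by_cases huV : u ∈ V
    · left
      have h1 : D.height w ≠ D.height u := fun h =>
        disjoint_left.mp hWK huV.2 (mem_image_of_mem _ ⟨hu, h.symm⟩)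
      have h2 := lt_of_le_of_ne huV.1 h1
      exact ⟨⟨height_pos.mp (hpos.trans h2), huV.2⟩, h2⟩
    · exact Or.inr huV
  obtain ⟨u, -, hu, hu'⟩ := hS' U Vᶜ hUo hVc.isOpen_compl hcov
    ⟨y, hy, ⟨hyt, hyW⟩, lt_of_le_of_ne hwy.height_le fun h => hw (hwy.eq_of_height h.ge ▸ hy)⟩
    ⟨x, hx, fun h => hw (hxw.eq_of_height h.1 ▸ hx)⟩
  exact hu' ⟨(show D.height w < D.height u from hu.2).le, hu.1.2⟩

theorem fibre_eq_of_isPreconnected [TotallySeparatedSpace Z] {S : Set F} (hS : IsPreconnected S)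
    (ht : D.top ∉ S) {x y : F} (hx : x ∈ S) (hy : y ∈ S) : D.fibre x = D.fibre y :=
  (hS.image D.fibre (D.continuousOn_fibre.mono fun _ hu h => ht (h ▸ hu))).subsingleton
    (mem_image_of_mem _ hx) (mem_image_of_mem _ hy)

theorem comparable_of_isPreconnected [TotallySeparatedSpace Z] {S : Set F} (hS : IsPreconnected S)
    {x y : F} (hx : x ∈ S) (hy : y ∈ S) : D.top ∈ S ∨ D.le x y ∨ D.le y x := by
  by_cases ht : D.top ∈ S
  · exact Or.inl ht
  · exact Or.inr (le_total_of_fibre (fibre_eq_of_isPreconnected hS ht hx hy))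

/-- Any two points are joined inside `S` by order segments, either directly or through `top`. This
is the converse of `mem_of_le_of_le` and `comparable_of_isPreconnected`. -/
theorem isPreconnected_of_convex [CompactSpace F] [T2Space F] [T2Space Z] {S : Set F}
    (hS : ∀ x ∈ S, ∀ y ∈ S, ∀ w, D.le x w → D.le w y → w ∈ S)
    (hS' : ∀ x ∈ S, ∀ y ∈ S, D.top ∈ S ∨ D.le x y ∨ D.le y x) : IsPreconnected S := by
  refine isPreconnected_of_forall_pair fun x hx y hy => ?_
  rcases hS' x hx y hy with ht | h | h
  · refine ⟨D.seg D.top x ∪ D.seg D.top y, union_subset (fun w hw => hS _ ht _ hx w hw.1 hw.2)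
      (fun w hw => hS _ ht _ hy w hw.1 hw.2), Or.inl ⟨top_le x, le_refl x⟩,
      Or.inr ⟨top_le y, le_refl y⟩, ?_⟩
    exact IsPreconnected.union D.top ⟨top_le _, top_le _⟩ ⟨top_le _, top_le _⟩
      (isPreconnected_seg (top_le x)) (isPreconnected_seg (top_le y))
  · exact ⟨D.seg x y, fun w hw => hS _ hx _ hy w hw.1 hw.2, ⟨le_refl x, h⟩, ⟨h, le_refl y⟩,
      isPreconnected_seg h⟩
  · exact ⟨D.seg y x, fun w hw => hS _ hy _ hx w hw.1 hw.2, ⟨h, le_refl x⟩, ⟨le_refl y, h⟩,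
      isPreconnected_seg h⟩

/-- Convexity passes to intersections, and so does the alternative "contains `top` or is a chain".
The intersection is nonempty because `A` and `B` are closed and cover a connected set. -/
theorem isUnicoherent [CompactSpace F] [T2Space F] [TotallySeparatedSpace Z] (D : FanModel F Z)
    {S : Set F} (hS : IsSubcontinuum S) : IsUnicoherent S := by
  rintro A B ⟨hA, hA'⟩ ⟨hB, hB'⟩ rfl
  refine ⟨?_, ?_⟩
  · have := hS.2.isPreconnected
    rw [isPreconnected_closed_iff] at this
    obtain ⟨u, -, hu⟩ := this A B hA.isClosed hB.isClosed Subset.rfl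
      (by rw [inter_eq_self_of_subset_right subset_union_left]; exact hA'.nonempty)
      (by rw [inter_eq_self_of_subset_right subset_union_right]; exact hB'.nonempty)
    exact ⟨u, hu⟩
  · refine isPreconnected_of_convex (D := D) (fun x hx y hy w h1 h2 =>
      ⟨mem_of_le_of_le hA.isClosed hA'.isPreconnected hx.1 hy.1 h1 h2,
        mem_of_le_of_le hB.isClosed hB'.isPreconnected hx.2 hy.2 h1 h2⟩) fun x hx y hy => ?_
    rcases comparable_of_isPreconnected (D := D) hA'.isPreconnected hx.1 hy.1 with h | h
    · rcases comparable_of_isPreconnected (D := D) hB'.isPreconnected hx.2 hy.2 with h' | h'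
      · exact Or.inl ⟨h, h'⟩
      · exact Or.inr h'
    · exact Or.inr h

end FanModel

/-! ### Arcs, segments and endpoints in terms of the order. -/

namespace FanModel

variable {F Z : Type*} [TopologicalSpace F] [TopologicalSpace Z] {D : FanModel F Z}

theorem mem_seg_top {x w : F} : w ∈ D.seg D.top x ↔ D.le w x := and_iff_right (top_le w)

theorem le_or_fibre {x y w : F} (hw : D.le w x) (hxy : D.fibre x ≠ D.fibre y) :
    w = D.top ∨ D.fibre w ≠ D.fibre y := by
  rcases hw with hw | hw
  · exact Or.inl hw
  · exact Or.inr (hw.1 ▸ hxy)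

section Arcs

variable [CompactSpace F] [T2Space F] [T2Space Z]

theorem isArc_seg {x y : F} (h : D.le x y) (hne : x ≠ y) :
    IsArc (D.seg x y) ∧ ∀ w ∈ D.seg x y, IsArcEndpoint (D.seg x y) w ↔ w = x ∨ w = y := by
  have hlt : D.height x < D.height y := lt_of_not_ge fun h' => hne (h.eq_of_height h')
  have hi := D.injOn_height_seg x y
  obtain ⟨h1, h2⟩ := isArc_of_image_eq_Icc hlt (isClosed_seg x y).isCompact D.height
    D.continuous_height.continuousOn hi (image_height_seg h)
  refine ⟨h1, fun w hw => ?_⟩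
  rw [h2 w hw, hi.eq_iff hw ⟨le_refl x, h⟩, hi.eq_iff hw ⟨h, le_refl y⟩]

-- Two blades are unfolded onto an interval by the signed height, negative on the side of `x`.
open Classical in
theorem isArc_union {x y : F} (hx : x ≠ D.top) (hy : y ≠ D.top) (hxy : D.fibre x ≠ D.fibre y) :
    IsArc (D.seg D.top x ∪ D.seg D.top y) ∧ ∀ w ∈ D.seg D.top x ∪ D.seg D.top y,
      IsArcEndpoint (D.seg D.top x ∪ D.seg D.top y) w ↔ w = x ∨ w = y := by
  -- The fibre of `top` carries no information, but the height is zero there, so both branches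
  -- agree.
  let f : F → ℝ := fun w => if D.fibre w = D.fibre y then D.height w else -D.height w
  have h1 : EqOn f (fun w => -D.height w) (D.seg D.top x) := by
    intro w hw
    rcases le_or_fibre (mem_seg_top.mp hw) hxy with rfl | h
    · simp [f, height_top]
    · simp [f, h]
  have h2 : EqOn f D.height (D.seg D.top y) := by
    intro w hw
    rcases mem_seg_top.mp hw with rfl | h
    · simp [f, height_top]
    · simp [f, h.1]
  have hc : ContinuousOn f (D.seg D.top x ∪ D.seg D.top y) :=
    ((D.continuous_height.neg.continuousOn).congr h1).union_of_isClosed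
      (D.continuous_height.continuousOn.congr h2) (isClosed_seg _ _) (isClosed_seg _ _)
  have hpx := height_pos.mpr hx
  have hpy := height_pos.mpr hy
  have himg : f '' (D.seg D.top x ∪ D.seg D.top y) = Icc (-D.height x) (D.height y) := by
    have h3 : (fun w => -D.height w) '' D.seg D.top x = Icc (-D.height x) 0 := by
      rw [← image_image (fun s : ℝ => -s) D.height, image_height_seg (top_le x), height_top]
      simp
    rw [image_union, h1.image_eq, h2.image_eq, h3, image_height_seg (top_le y), height_top,
      Icc_union_Icc_eq_Icc (by linarith) hpy.le]
  have hcross : ∀ w ∈ D.seg D.top x, ∀ w' ∈ D.seg D.top y, f w = f w' → w = w' := by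
    intro w hw w' hw' h
    rw [h1 hw, h2 hw'] at h
    simp only at h
    have a := D.height_nonneg w
    have b := D.height_nonneg w'
    rw [(D.height_eq_zero w).mp (by linarith), (D.height_eq_zero w').mp (by linarith)]
  have hi : InjOn f (D.seg D.top x ∪ D.seg D.top y) := by
    rintro w (hw | hw) w' (hw' | hw') h
    · rw [h1 hw, h1 hw'] at h
      exact injOn_height_seg _ _ hw hw' (neg_injective h)
    · exact hcross w hw w' hw' h
    · exact (hcross w' hw' w hw h.symm).symm
    · rw [h2 hw, h2 hw'] at h
      exact injOn_height_seg _ _ hw hw' h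
  obtain ⟨h5, h6⟩ := isArc_of_image_eq_Icc (by linarith)
    ((isClosed_seg _ _).union (isClosed_seg _ _)).isCompact f hc hi himg
  refine ⟨h5, fun w hw => ?_⟩
  have hxm : x ∈ D.seg D.top x := mem_seg_top.mpr (le_refl x)
  have hym : y ∈ D.seg D.top y := mem_seg_top.mpr (le_refl y)
  rw [h6 w hw, ← hi.eq_iff hw (Or.inl hxm), ← hi.eq_iff hw (Or.inr hym), h1 hxm, h2 hym]

theorem exists_isSegment (D : FanModel F Z) (x y : F) : ∃ S : Set F, IsSegment x y S := by
  by_cases hxy : x = y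
  · exact ⟨{x}, Or.inl ⟨hxy, rfl⟩⟩
  by_cases h : D.le x y
  · obtain ⟨h1, h2⟩ := isArc_seg h hxy
    exact ⟨D.seg x y, Or.inr ⟨hxy, h1, (h2 x ⟨le_refl x, h⟩).mpr (Or.inl rfl),
      (h2 y ⟨h, le_refl y⟩).mpr (Or.inr rfl)⟩⟩
  by_cases h' : D.le y x
  · obtain ⟨h1, h2⟩ := isArc_seg h' (Ne.symm hxy)
    exact ⟨D.seg y x, Or.inr ⟨hxy, h1, (h2 x ⟨h', le_refl x⟩).mpr (Or.inr rfl),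
      (h2 y ⟨le_refl y, h'⟩).mpr (Or.inl rfl)⟩⟩
  have hx : x ≠ D.top := fun hx => h (Or.inl hx)
  have hy : y ≠ D.top := fun hy => h' (Or.inl hy)
  have hf : D.fibre x ≠ D.fibre y := fun hf => (le_total_of_fibre hf).elim h h'
  obtain ⟨h1, h2⟩ := isArc_union hx hy hf
  exact ⟨_, Or.inr ⟨hxy, h1, (h2 x (Or.inl (mem_seg_top.mpr (le_refl x)))).mpr (Or.inl rfl),
    (h2 y (Or.inr (mem_seg_top.mpr (le_refl y)))).mpr (Or.inr rfl)⟩⟩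

theorem isSegment_seg_top (x : F) : IsSegment D.top x (D.seg D.top x) := by
  by_cases hx : D.top = x
  · refine Or.inl ⟨hx, ?_⟩
    ext w
    rw [mem_seg_top, mem_singleton_iff]
    subst hx
    exact ⟨fun h => h.antisymm (top_le w), fun h => h ▸ le_refl _⟩
  · obtain ⟨h1, h2⟩ := isArc_seg (top_le x) hx
    exact Or.inr ⟨hx, h1, (h2 _ ⟨le_refl _, top_le x⟩).mpr (Or.inl rfl),
      (h2 x ⟨top_le x, le_refl x⟩).mpr (Or.inr rfl)⟩

end Arcs

section TotallySeparated

variable [CompactSpace F] [T2Space F] [TotallySeparatedSpace Z]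

/-- Uniqueness of arcs from the top: by convexity an arc from `top` to `x` contains the order
segment, which is connected and contains both ends, hence is the whole arc. -/
theorem eq_seg_of_isSegment {x : F} {S : Set F} (h : IsSegment D.top x S) :
    S = D.seg D.top x := by
  rcases h with ⟨hx, rfl⟩ | ⟨hx, hS, h1, h2⟩
  · subst hx
    ext w
    rw [mem_seg_top, mem_singleton_iff]
    exact ⟨fun h => h ▸ le_refl _, fun h => h.antisymm (top_le w)⟩
  · exact (hS.eq_of_isPreconnected hx h1 h2 (isPreconnected_seg (top_le x))
      (fun w hw => mem_of_le_of_le hS.isCompact.isClosed hS.isConnected.isPreconnected h1.1 h2.1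
        hw.1 hw.2) ⟨le_refl _, top_le x⟩ ⟨top_le x, le_refl x⟩).symm

/-- A point with something above it is interior to a longer segment, and `top` is interior to a
union of two blades. Conversely, deleting a maximal point other than `top` from an arc keeps it
convex and does not remove `top`. -/
theorem mem_endpoints_iff {x : F} :
    x ∈ endpoints F ↔ x ≠ D.top ∧ ∀ y, D.le x y → y = x := by
  constructor
  · intro h
    have hx : x ≠ D.top := by
      rintro rfl
      obtain ⟨p, q, -, hp, hq, -, hpq, -⟩ := D.exists_three
      obtain ⟨h1, h2⟩ := isArc_union hp hq hpq
      have hm : D.top ∈ D.seg D.top p ∪ D.seg D.top q := Or.inl (mem_seg_top.mpr (top_le _))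
      exact ((h2 _ hm).mp (h _ h1 hm)).elim (fun h => hp h.symm) (fun h => hq h.symm)
    refine ⟨hx, fun y hy => ?_⟩
    obtain ⟨h1, h2⟩ := isArc_seg (top_le y) (hy.ne_top hx).symm
    have hm := mem_seg_top.mpr hy
    exact (((h2 _ hm).mp (h _ h1 hm)).resolve_left hx).symm
  · rintro ⟨hx, hmax⟩ A hA hxA
    refine ⟨hxA, ?_, ?_⟩
    · obtain ⟨y, hy, hyx⟩ := hA.nontrivial.exists_ne x
      exact ⟨y, hy, hyx⟩
    · refine isPreconnected_of_convex (D := D) (fun y hy z hz w h1 h2 =>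
        ⟨mem_of_le_of_le hA.isCompact.isClosed hA.isConnected.isPreconnected hy.1 hz.1 h1 h2, ?_⟩)
        fun y hy z hz => ?_
      · rintro rfl
        exact hz.2 (hmax z h2)
      · exact (comparable_of_isPreconnected hA.isConnected.isPreconnected hy.1 hz.1).imp_left
          fun h => ⟨h, fun h' => hx h'.symm⟩

end TotallySeparated

end FanModel

/-! ## The model triod -/

theorem isCompact_modelTriod : IsCompact modelTriod :=
  (isCompact_Icc.prod isCompact_singleton).union (isCompact_singleton.prod isCompact_Icc)

theorem isPreconnected_modelTriod : IsPreconnected modelTriod :=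
  IsPreconnected.union ((0 : ℝ), (0 : ℝ)) (by simp) (by simp)
    ((convex_Icc _ _).prod (convex_singleton _)).isPreconnected
    ((convex_singleton _).prod (convex_Icc _ _)).isPreconnected

/-- A continuous function vanishing on a triod at its top only separates any connected set
missing the top. -/
theorem false_of_modelTriod_separation {F : Type*} [TopologicalSpace F] {T : Set F}
    (e : T ≃ₜ modelTriod) {x : F} (hx : x ∈ T) (hex : (e ⟨x, hx⟩ : ℝ × ℝ) = (0, 0))
    {f : ℝ × ℝ → ℝ} (hf : Continuous f) (hf0 : ∀ p ∈ modelTriod, f p = 0 → p = (0, 0))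
    {S : Set F} (hS : IsPreconnected S) (hST : S ⊆ T) (hxS : x ∉ S) {p q : T} (hp : (p : F) ∈ S)
    (hq : (q : F) ∈ S) (hfp : f (e p) < 0) (hfq : 0 < f (e q)) : False := by
  have hpre : IsPreconnected (Subtype.val ⁻¹' S : Set T) := by
    rw [← IsInducing.subtypeVal.isPreconnected_image, Subtype.image_preimage_coe,
      inter_eq_self_of_subset_right hST]
    exact hS
  have hcont : Continuous fun w : T => f (e w) :=
    hf.comp (continuous_subtype_val.comp e.continuous)
  obtain ⟨w, hw, hw0⟩ := hpre.intermediate_value hp hq hcont.continuousOn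
    (⟨hfp.le, hfq.le⟩ : (0 : ℝ) ∈ Icc _ _)
  have h1 := hf0 _ (e w).2 hw0
  have h2 : w = ⟨x, hx⟩ := e.injective (Subtype.ext (h1.trans hex.symm))
  subst h2
  exact hxS hw

/-! ### The top is the only ramification point. -/

namespace FanModel

variable {F Z : Type*} [TopologicalSpace F] [TopologicalSpace Z] {D : FanModel F Z}
variable [CompactSpace F] [T2Space F]

-- Three segments in distinct fibres are sent to the three legs of the model by their normalized
-- heights.
open Classical in
theorem isRamificationPoint_top [T2Space Z] : IsRamificationPoint D.top := by
  obtain ⟨x, y, z, hx, hy, hz, hxy, hxz, hyz⟩ := D.exists_three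
  let f : F → ℝ × ℝ := fun w => if D.fibre w = D.fibre x then (-(D.height w / D.height x), 0)
    else if D.fibre w = D.fibre y then (D.height w / D.height y, 0) else (0, D.height w / D.height z)
  have hpx := height_pos.mpr hx
  have hpy := height_pos.mpr hy
  have hpz := height_pos.mpr hz
  have hft : f D.top = (0, 0) := by simp [f, height_top]
  have h1 : EqOn f (fun w => (-(D.height w / D.height x), 0)) (D.seg D.top x) := by
    intro w hw
    rcases mem_seg_top.mp hw with rfl | h
    · rw [hft]; simp [height_top]
    · simp [f, h.1]
  have h2 : EqOn f (fun w => (D.height w / D.height y, 0)) (D.seg D.top y) := by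
    intro w hw
    rcases mem_seg_top.mp hw with rfl | h
    · rw [hft]; simp [height_top]
    · simp [f, h.1, hxy.symm]
  have h3 : EqOn f (fun w => (0, D.height w / D.height z)) (D.seg D.top z) := by
    intro w hw
    rcases mem_seg_top.mp hw with rfl | h
    · rw [hft]; simp [height_top]
    · simp [f, h.1, hxz.symm, hyz.symm]
  have hh := D.continuous_height
  have i1 : f '' D.seg D.top x = Icc (-1) 0 ×ˢ {0} := by
    rw [h1.image_eq, ← image_image (fun s : ℝ => ((-(s / D.height x), 0) : ℝ × ℝ)) D.height,
      image_height_seg (top_le x), height_top]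
    ext ⟨a, b⟩
    simp only [mem_image, mem_Icc, Prod.mk.injEq, mem_prod, mem_singleton_iff]
    constructor
    · rintro ⟨s, ⟨hs, hs'⟩, rfl, rfl⟩
      refine ⟨⟨?_, ?_⟩, rfl⟩
      · rw [neg_le_neg_iff, div_le_one hpx]; exact hs'
      · simp; positivity
    · rintro ⟨⟨ha, ha'⟩, rfl⟩
      refine ⟨-a * D.height x, ⟨by nlinarith, by nlinarith⟩, by field_simp, rfl⟩
  have i2 : f '' D.seg D.top y = Icc 0 1 ×ˢ {0} := by
    rw [h2.image_eq, ← image_image (fun s : ℝ => ((s / D.height y, 0) : ℝ × ℝ)) D.height,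
      image_height_seg (top_le y), height_top]
    ext ⟨a, b⟩
    simp only [mem_image, mem_Icc, Prod.mk.injEq, mem_prod, mem_singleton_iff]
    constructor
    · rintro ⟨s, ⟨hs, hs'⟩, rfl, rfl⟩
      exact ⟨⟨by positivity, (div_le_one hpy).mpr hs'⟩, rfl⟩
    · rintro ⟨⟨ha, ha'⟩, rfl⟩
      refine ⟨a * D.height y, ⟨by nlinarith, by nlinarith⟩, by field_simp, rfl⟩
  have i3 : f '' D.seg D.top z = {0} ×ˢ Icc 0 1 := by
    rw [h3.image_eq, ← image_image (fun s : ℝ => ((0, s / D.height z) : ℝ × ℝ)) D.height,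
      image_height_seg (top_le z), height_top]
    ext ⟨a, b⟩
    simp only [mem_image, mem_Icc, Prod.mk.injEq, mem_prod, mem_singleton_iff]
    constructor
    · rintro ⟨s, ⟨hs, hs'⟩, rfl, rfl⟩
      exact ⟨rfl, by positivity, (div_le_one hpz).mpr hs'⟩
    · rintro ⟨rfl, ha, ha'⟩
      refine ⟨b * D.height z, ⟨by nlinarith, by nlinarith⟩, rfl, by field_simp⟩
  let T : Set F := (D.seg D.top x ∪ D.seg D.top y) ∪ D.seg D.top z
  have hTc : IsCompact T := (((isClosed_seg _ _).union (isClosed_seg _ _)).union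
    (isClosed_seg _ _)).isCompact
  have hcont : ContinuousOn f T := by
    refine ContinuousOn.union_of_isClosed (ContinuousOn.union_of_isClosed
      (ContinuousOn.congr ?_ h1) (ContinuousOn.congr ?_ h2) (isClosed_seg _ _) (isClosed_seg _ _))
      (ContinuousOn.congr ?_ h3) ((isClosed_seg _ _).union (isClosed_seg _ _)) (isClosed_seg _ _)
    all_goals exact Continuous.continuousOn (by fun_prop)
  have himg : f '' T = modelTriod := by
    rw [image_union, image_union, i1, i2, i3, ← union_prod,
      Icc_union_Icc_eq_Icc (by norm_num) (by norm_num)]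
    rfl
  have hpos : ∀ w ∈ T, w ≠ D.top → (D.fibre w = D.fibre x ∨ D.fibre w = D.fibre y ∨
      D.fibre w = D.fibre z) := by
    rintro w ((hw | hw) | hw) ht
    · exact Or.inl ((mem_seg_top.mp hw).fibre_eq ht)
    · exact Or.inr (Or.inl ((mem_seg_top.mp hw).fibre_eq ht))
    · exact Or.inr (Or.inr ((mem_seg_top.mp hw).fibre_eq ht))
  have hf0 : ∀ w, f w = (0, 0) → w = D.top := by
    intro w hw
    by_contra ht
    have := height_pos.mpr ht
    simp only [f] at hw
    split_ifs at hw <;> simp [this.ne', hpx.ne', hpy.ne', hpz.ne'] at hw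
  have hi : InjOn f T := by
    intro w hw w' hw' h
    by_cases ht : w = D.top
    · rw [ht] at h ⊢
      exact (hf0 w' (h ▸ hft)).symm
    by_cases ht' : w' = D.top
    · rw [ht'] at h ⊢
      exact hf0 w (h.symm ▸ hft)
    have h0 := height_pos.mpr ht
    have h0' := height_pos.mpr ht'
    have pos : ∀ a b : ℝ, 0 < a → 0 < b → 0 < a / b := fun a b ha hb => div_pos ha hb
    have a1 := pos _ _ h0 hpx
    have a2 := pos _ _ h0 hpy
    have a3 := pos _ _ h0 hpz
    have b1 := pos _ _ h0' hpx
    have b2 := pos _ _ h0' hpy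
    have b3 := pos _ _ h0' hpz
    rcases hpos w hw ht with e | e | e <;> rcases hpos w' hw' ht' with e' | e' | e' <;>
      simp only [f, e, e', hxy.symm, hxz.symm, hyz.symm, if_true, if_false, Prod.mk.injEq] at h
    · refine D.ext _ _ ht ht' (e.trans e'.symm) ?_
      have := h.1
      field_simp at this
      linarith
    · linarith [h.1]
    · linarith [h.1]
    · linarith [h.1]
    · refine D.ext _ _ ht ht' (e.trans e'.symm) ?_
      have := h.1
      field_simp at this
      linarith
    · linarith [h.1]
    · linarith [h.1]
    · linarith [h.1]
    · refine D.ext _ _ ht ht' (e.trans e'.symm) ?_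
      have := h.2
      field_simp at this
      linarith
  obtain ⟨e, he⟩ := exists_homeomorph_of_injOn hTc f hcont hi himg
  exact ⟨T, e, Or.inl (Or.inl (mem_seg_top.mpr (top_le _))), by rw [he]; exact hft⟩

variable [TotallySeparatedSpace Z]

/-- If `x ≠ top`, a triod minus `x` is the union of two connected sets: its points strictly above
`x` and its points not above `x`. A triod minus its top has three legs, so two of the three tips
would share a connected set. -/
theorem eq_top_of_isRamificationPoint {x : F} (h : IsRamificationPoint x) : x = D.top := by
  by_contra hxt
  obtain ⟨T, e, hx, hex⟩ := h
  have hT : IsCompact T := by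
    have := isCompact_iff_compactSpace.mp isCompact_modelTriod
    have := e.symm.compactSpace
    exact isCompact_iff_compactSpace.mpr this
  have hT' : IsPreconnected T := by
    have : PreconnectedSpace modelTriod :=
      isPreconnected_iff_preconnectedSpace.mp isPreconnected_modelTriod
    have hr := isPreconnected_range (continuous_subtype_val.comp e.symm.continuous)
    rwa [e.symm.surjective.range_comp, Subtype.range_val] at hr
  let S : Bool → Set F := fun b => if b then {w | w ∈ T ∧ D.le x w ∧ w ≠ x} else
    {w | w ∈ T ∧ ¬D.le x w}
  have hSp : ∀ b, IsPreconnected (S b) := by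
    intro b
    cases b
    · refine isPreconnected_of_convex (D := D) (fun p hp q hq w h1 h2 =>
        ⟨mem_of_le_of_le hT.isClosed hT' hp.1 hq.1 h1 h2, fun h => hq.2 (h.trans h2)⟩)
        fun p hp q hq => ?_
      exact (comparable_of_isPreconnected hT' hp.1 hq.1).imp_left
        fun h => ⟨h, fun h' => hxt (h'.antisymm (top_le x))⟩
    · refine isPreconnected_of_convex (D := D) (fun p hp q hq w h1 h2 =>
        ⟨mem_of_le_of_le hT.isClosed hT' hp.1 hq.1 h1 h2, hp.2.1.trans h1, ?_⟩)
        fun p hp q hq => ?_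
      · rintro rfl
        exact hp.2.2 (h1.antisymm hp.2.1)
      · exact Or.inr (le_total_of_fibre
          ((hp.2.1.fibre_eq hxt).symm.trans (hq.2.1.fibre_eq hxt)))
  have hST : ∀ b, S b ⊆ T := by
    intro b w hw
    cases b
    · exact hw.1
    · exact hw.1
  have hxS : ∀ b, x ∉ S b := by
    intro b h
    cases b
    · exact h.2 (le_refl x)
    · exact h.2.2 rfl
  have hcov : ∀ w : T, (w : F) ≠ x → ∃ b, (w : F) ∈ S b := by
    intro w hw
    by_cases h : D.le x w
    · exact ⟨true, w.2, h, hw⟩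
    · exact ⟨false, w.2, h⟩
  have hpt : ∀ p : modelTriod, (p : ℝ × ℝ) ≠ (0, 0) → ∃ b, (e.symm p : F) ∈ S b := by
    intro p hp
    refine hcov _ fun h => hp ?_
    have : e.symm p = ⟨x, hx⟩ := Subtype.ext h
    rw [← hex, ← this, e.apply_symm_apply]
  -- On the triod both functions vanish only at the top. The difference of coordinates separates the
  -- right tip from the other two, and the sum separates the left tip from the upper one.
  have hz : ∀ (f : ℝ × ℝ → ℝ), (f = fun p => p.1 - p.2) ∨ (f = fun p => p.1 + p.2) →
      ∀ p ∈ modelTriod, f p = 0 → p = (0, 0) := by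
    rintro f hf ⟨a, b⟩ (⟨-, hb⟩ | ⟨ha, -⟩) h
    · simp only [mem_singleton_iff] at hb
      rcases hf with rfl | rfl <;> simp_all
    · simp only [mem_singleton_iff] at ha
      rcases hf with rfl | rfl <;> simp_all
  let p₁ : modelTriod := ⟨(-1, 0), Or.inl (by simp)⟩
  let p₂ : modelTriod := ⟨(1, 0), Or.inl (by simp)⟩
  let p₃ : modelTriod := ⟨(0, 1), Or.inr (by simp)⟩
  have sep : ∀ b, ∀ p q : modelTriod, (e.symm p : F) ∈ S b → (e.symm q : F) ∈ S b →
      ∀ (f : ℝ × ℝ → ℝ), Continuous f → (f = fun p => p.1 - p.2) ∨ (f = fun p => p.1 + p.2) →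
      f p < 0 → 0 < f q → False := by
    intro b p q hp hq f hf hf' h1 h2
    exact false_of_modelTriod_separation e hx hex hf (hz f hf') (hSp b) (hST b) (hxS b) hp hq
      (by simpa using h1) (by simpa using h2)
  obtain ⟨b₁, hb₁⟩ := hpt p₁ (by simp [p₁])
  obtain ⟨b₂, hb₂⟩ := hpt p₂ (by simp [p₂])
  obtain ⟨b₃, hb₃⟩ := hpt p₃ (by simp [p₃])
  have n12 : b₁ ≠ b₂ := by
    rintro rfl
    exact sep _ p₁ p₂ hb₁ hb₂ _ (by fun_prop) (Or.inl rfl) (by simp [p₁]) (by simp [p₂])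
  have n32 : b₃ ≠ b₂ := by
    rintro rfl
    exact sep _ p₃ p₂ hb₃ hb₂ _ (by fun_prop) (Or.inl rfl) (by simp [p₃]) (by simp [p₂])
  have n13 : b₁ ≠ b₃ := by
    rintro rfl
    exact sep _ p₁ p₃ hb₁ hb₃ _ (by fun_prop) (Or.inr rfl) (by simp [p₁]) (by simp [p₃])
  cases b₁ <;> cases b₂ <;> cases b₃ <;>
    first | exact n12 rfl | exact n32 rfl | exact n13 rfl

theorem isRamificationPoint_iff {x : F} : IsRamificationPoint x ↔ x = D.top :=
  ⟨eq_top_of_isRamificationPoint, fun h => h ▸ isRamificationPoint_top⟩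

end FanModel

/-! ### Fans presented by a model are smooth. -/

namespace FanModel

variable {F Z : Type*} [TopologicalSpace F] [TopologicalSpace Z] {D : FanModel F Z}
variable [CompactSpace F]

/-- By compactness it suffices to identify cluster points. Such a point has the height of `w`, so it
is not `top`. The fibre map is then continuous there, and height and fibre determine the point. -/
theorem tendsto_of_height_of_fibre [T1Space F] [T2Space Z] {ι : Type*} {l : Filter ι} {u : ι → F} {w : F}
    (hw : w ≠ D.top) (hh : Tendsto (fun i => D.height (u i)) l (𝓝 (D.height w)))
    (hf : Tendsto (fun i => D.fibre (u i)) l (𝓝 (D.fibre w))) : Tendsto u l (𝓝 w) := by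
  refine isCompact_univ.tendsto_nhds_of_unique_mapClusterPt (by simp) fun y _ hy => ?_
  obtain ⟨U, hU, hUy⟩ := mapClusterPt_iff_ultrafilter.mp hy
  have h1 : D.height y = D.height w :=
    tendsto_nhds_unique ((D.continuous_height.tendsto y).comp hUy) (hh.mono_left hU)
  have hyt : y ≠ D.top := height_pos.mp (h1 ▸ height_pos.mpr hw)
  have h2 : D.fibre y = D.fibre w := tendsto_nhds_unique
    ((D.continuousOn_fibre.continuousAt (isOpen_compl_top.mem_nhds hyt)).tendsto.comp hUy)
    (hf.mono_left hU)
  exact D.ext y w hyt hw h2 h1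

theorem continuum [MetrizableSpace F] [TotallySeparatedSpace Z] (D : FanModel F Z) :
    IsContinuum F := by
  refine ⟨inferInstance, ?_, inferInstance⟩
  have h : IsPreconnected (univ : Set F) := isPreconnected_of_convex (D := D)
    (fun _ _ _ _ _ _ _ => mem_univ _) fun _ _ _ _ => Or.inl (mem_univ _)
  exact connectedSpace_iff_univ.mpr ⟨⟨D.top, mem_univ _⟩, h⟩

theorem isFan [MetrizableSpace F] [TotallySeparatedSpace Z] (D : FanModel F Z) : IsFan F :=
  ⟨⟨D.continuum, D.exists_isSegment, fun _ hS => D.isUnicoherent hS⟩,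
    D.top, isRamificationPoint_top, fun _ => eq_top_of_isRamificationPoint⟩

/-- Convergence is tested on the two kinds of Vietoris subbasic sets. For "contained in `U`", the
points above some point outside `U` form a closed set, by compactness and closedness of the order.
For "meets `U`", a point `w` below `x₀` is approximated by the points below `x n` at height `min
(height w) (height (x n))`. -/
theorem tendsto_seg_top [T2Space F] [T2Space Z] {ι : Type*} {l : Filter ι} {x : ι → F} {x₀ : F}
    (hx : Tendsto x l (𝓝 x₀)) {S : ι → NonemptyCompacts F} {S₀ : NonemptyCompacts F}
    (hS : ∀ n, (S n : Set F) = D.seg D.top (x n)) (hS₀ : (S₀ : Set F) = D.seg D.top x₀) :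
    Tendsto S l (𝓝 S₀) := by
  let := TopologicalSpace.vietoris F
  rw [NonemptyCompacts.isEmbedding_coe.isInducing.tendsto_nhds_iff, TopologicalSpace.vietoris,
    tendsto_nhds_generateFrom_iff]
  rintro s (⟨U, hU, rfl⟩ | ⟨U, hU, rfl⟩) hs
  · have hsU : D.seg D.top x₀ ⊆ U := by
      have : (S₀ : Set F) ⊆ U := hs
      rwa [hS₀] at this
    have hcl : IsClosed (Prod.snd '' ({p : F × F | D.le p.1 p.2} ∩ Prod.fst ⁻¹' Uᶜ)) :=
      isClosedMap_snd_of_compactSpace _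
        (D.isClosed_le.inter (hU.isClosed_compl.preimage continuous_fst))
    have hmem : x₀ ∈ (Prod.snd '' ({p : F × F | D.le p.1 p.2} ∩ Prod.fst ⁻¹' Uᶜ))ᶜ := by
      rintro ⟨⟨w, _⟩, ⟨h1, h2⟩, rfl⟩
      exact h2 (hsU (mem_seg_top.mpr h1))
    filter_upwards [hx (hcl.isOpen_compl.mem_nhds hmem)] with n hn
    show (S n : Set F) ⊆ U
    rw [hS]
    intro w hw
    by_contra hwU
    exact hn ⟨(w, x n), ⟨mem_seg_top.mp hw, hwU⟩, rfl⟩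
  · obtain ⟨w, hw, hwU⟩ : ((S₀ : Set F) ∩ U).Nonempty := hs
    rw [hS₀, mem_seg_top] at hw
    have hT : ∀ n, (S n : Set F) ∈ {t | (t ∩ U).Nonempty} ↔ ∃ w, D.le w (x n) ∧ w ∈ U := by
      intro n
      simp only [hS, mem_ofPred_eq, Set.Nonempty, mem_inter_iff, mem_seg_top]
    by_cases hwt : w = D.top
    · filter_upwards with n
      exact (hT n).mpr ⟨w, Or.inl hwt, hwU⟩
    have hpos := height_pos.mpr hwt
    have hx0 := hw.ne_top hwt
    have hex : ∀ n, ∃ y, D.le y (x n) ∧ D.height y = min (D.height w) (D.height (x n)) :=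
      fun n => exists_le_height (le_min hpos.le (D.height_nonneg _)) (min_le_right _ _)
    choose y hy hy' using hex
    have hxh : Tendsto (fun n => D.height (x n)) l (𝓝 (D.height x₀)) :=
      (D.continuous_height.tendsto _).comp hx
    have hyh : Tendsto (fun n => D.height (y n)) l (𝓝 (D.height w)) := by
      simp_rw [hy']
      have := (tendsto_const_nhds (x := D.height w)).min hxh
      rwa [min_eq_left hw.height_le] at this
    have hyf : Tendsto (fun n => D.fibre (y n)) l (𝓝 (D.fibre w)) := by
      have h1 : Tendsto (fun n => D.fibre (x n)) l (𝓝 (D.fibre w)) := by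
        rw [hw.fibre_eq hwt]
        exact (D.continuousOn_fibre.continuousAt (isOpen_compl_top.mem_nhds hx0)).tendsto.comp hx
      refine h1.congr' ?_
      filter_upwards [hyh.eventually_const_lt hpos] with n hn
      exact ((hy n).fibre_eq (height_pos.mp hn)).symm
    filter_upwards [(tendsto_of_height_of_fibre hwt hyh hyf) (hU.mem_nhds hwU)] with n hn
    exact (hT n).mpr ⟨y n, hy n, hn⟩

theorem isSmoothFan [MetrizableSpace F] [TotallySeparatedSpace Z] (D : FanModel F Z) :
    IsSmoothFan F := by
  refine ⟨D.isFan, fun t ht x x₀ S S₀ hS hS₀ hx => ?_⟩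
  obtain rfl := (isRamificationPoint_iff (D := D)).mp ht
  exact tendsto_seg_top hx (fun n => eq_seg_of_isSegment (hS n)) (eq_seg_of_isSegment hS₀)

/-- Transport of a presentation along a homeomorphism. -/
def congr {F' : Type*} [TopologicalSpace F'] (D : FanModel F Z) (e : F' ≃ₜ F) : FanModel F' Z where
  top := e.symm D.top
  height := D.height ∘ e
  fibre := D.fibre ∘ e
  continuous_height := D.continuous_height.comp e.continuous
  height_nonneg x := D.height_nonneg _
  height_eq_zero x := by
    rw [Function.comp_apply, D.height_eq_zero, Homeomorph.eq_symm_apply]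
  continuousOn_fibre := D.continuousOn_fibre.comp e.continuous.continuousOn
    fun x hx h => hx (by rw [mem_singleton_iff] at h ⊢; rw [← h, e.symm_apply_apply])
  ext x y hx hy h h' := e.injective (D.ext _ _ (fun h => hx (by rw [← h, e.symm_apply_apply]))
    (fun h => hy (by rw [← h, e.symm_apply_apply])) h h')
  exists_of_le x s h h' := by
    obtain ⟨y, hy, hy'⟩ := D.exists_of_le (e x) s h h'
    exact ⟨e.symm y, by simpa using hy, by simpa using hy'⟩
  exists_three := by
    obtain ⟨x, y, z, hx, hy, hz, hxy, hxz, hyz⟩ := D.exists_three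
    exact ⟨e.symm x, e.symm y, e.symm z, by simpa using hx, by simpa using hy, by simpa using hz,
      by simpa using hxy, by simpa using hxz, by simpa using hyz⟩

end FanModel

/-! ## Topological invariance -/

section Invariance

variable {F G : Type*} [TopologicalSpace F] [TopologicalSpace G]

theorem IsArc.image {A : Set F} (hA : IsArc A) (h : F ≃ₜ G) : IsArc (h '' A) := by
  obtain ⟨φ⟩ := hA
  exact ⟨(h.image A).symm.trans φ⟩

theorem IsArcEndpoint.image {A : Set F} {x : F} (hx : IsArcEndpoint A x) (h : F ≃ₜ G) :
    IsArcEndpoint (h '' A) (h x) :=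
  (isArcEndpoint_iff_of_homeomorph (h.image A) ⟨x, hx.1⟩).mp hx

theorem IsSegment.image {A : Set F} {x y : F} (hA : IsSegment x y A) (h : F ≃ₜ G) :
    IsSegment (h x) (h y) (h '' A) := by
  rcases hA with ⟨rfl, rfl⟩ | ⟨hxy, hA, hx, hy⟩
  · exact Or.inl ⟨rfl, image_singleton⟩
  · exact Or.inr ⟨h.injective.ne hxy, hA.image h, hx.image h, hy.image h⟩

theorem apply_mem_endpoints (h : F ≃ₜ G) {x : F} (hx : x ∈ endpoints F) : h x ∈ endpoints G := by
  intro A hA hxA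
  have h1 := (hx _ (hA.image h.symm) ⟨h x, hxA, h.symm_apply_apply x⟩).image h
  rwa [← image_comp, h.self_comp_symm, image_id] at h1

theorem image_endpoints (h : F ≃ₜ G) : h '' endpoints F = endpoints G := by
  refine Subset.antisymm ?_ fun y hy =>
    ⟨h.symm y, apply_mem_endpoints h.symm hy, h.apply_symm_apply y⟩
  rintro _ ⟨x, hx, rfl⟩
  exact apply_mem_endpoints h hx

theorem IsRamificationPoint.image {x : F} (hx : IsRamificationPoint x) (h : F ≃ₜ G) :
    IsRamificationPoint (h x) := by
  obtain ⟨T, e, hxT, hex⟩ := hx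
  refine ⟨h '' T, (h.image T).symm.trans e, mem_image_of_mem h hxT, ?_⟩
  have : (h.image T).symm ⟨h x, mem_image_of_mem h hxT⟩ = ⟨x, hxT⟩ := by
    rw [Homeomorph.symm_apply_eq]
    rfl
  rw [Homeomorph.trans_apply, this, hex]

theorem image_mem_blades {t : F} {B : Set F} (hB : B ∈ blades t) (h : F ≃ₜ G) :
    h '' B ∈ blades (h t) := by
  obtain ⟨e, he, hB⟩ := hB
  exact ⟨h e, apply_mem_endpoints h he, hB.image h⟩

/-- `X` is the trace, on the blade `B` with top `t`, of the closure of the remaining endpoints. -/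
def IsBladeTrace (X : Set I) (t : F) (B : Set F) : Prop :=
  ∃ φ : I ≃ₜ B, (φ 0 : F) = t ∧ (fun s => (φ s : F)) '' X = B ∩ closure (endpoints F \ B)

theorem IsBladeTrace.image {X : Set I} {t : F} {B : Set F} (hB : IsBladeTrace X t B) (h : F ≃ₜ G) :
    IsBladeTrace X (h t) (h '' B) := by
  obtain ⟨φ, h0, hφ⟩ := hB
  refine ⟨φ.trans (h.image B), ?_, ?_⟩
  · rw [← h0]
    rfl
  · rw [← image_endpoints h, ← image_sdiff h.injective, ← h.image_closure, ← image_inter h.injective,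
      ← hφ, image_image]
    rfl

theorem IsEPG.congr {X : Set I} (hF : IsEPG F X) (hG : IsFan G) (h : F ≃ₜ G) : IsEPG G X := by
  refine ⟨hG, fun t ht B hB => ?_⟩
  have := IsBladeTrace.image (hF.2 _ (ht.image h.symm) _ (image_mem_blades hB h.symm)) h
  rwa [h.apply_symm_apply, ← image_comp, h.self_comp_symm, image_id] at this

theorem IsEndpointHomogeneous.congr (hF : IsEndpointHomogeneous F) (h : F ≃ₜ G) :
    IsEndpointHomogeneous G := by
  intro e he e' he'
  obtain ⟨g, hg⟩ := hF _ (apply_mem_endpoints h.symm he) _ (apply_mem_endpoints h.symm he')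
  exact ⟨h.symm.trans (g.trans h), by simp [hg]⟩

/-- Two parametrizations of the same blade differ by an increasing homeomorphism of `[0,1]`. -/
theorem IsBladeTrace.equivalentlyEmbedded {X Y : Set I} {t : F} {B : Set F}
    (hX : IsBladeTrace X t B) (hY : IsBladeTrace Y t B) : EquivalentlyEmbedded X Y := by
  obtain ⟨φ, h0, hφ⟩ := hX
  obtain ⟨ψ, h0', hψ⟩ := hY
  let g : I ≃ₜ I := φ.trans ψ.symm
  have hg0 : g 0 = 0 := by
    show ψ.symm (φ 0) = 0
    rw [ψ.symm_apply_eq]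
    exact Subtype.ext (h0.trans h0'.symm)
  refine ⟨g, ?_, ?_⟩
  · rcases g.continuous.strictMono_of_inj g.injective with h | h
    · exact h
    · have := h (zero_lt_one : (0 : I) < 1)
      rw [hg0] at this
      exact absurd this (not_lt.mpr (g 1).2.1)
  · have hinj : Function.Injective fun s => (ψ s : F) :=
      Subtype.val_injective.comp ψ.injective
    refine hinj.image_injective ?_
    rw [image_image, hψ, ← hφ]
    refine image_congr fun s _ => ?_
    show ((ψ (ψ.symm (φ s)) : B) : F) = φ s
    rw [ψ.apply_symm_apply]

theorem IsBladeTrace.of_equivalentlyEmbedded {X Y : Set I} {t : F} {B : Set F}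
    (hX : IsBladeTrace X t B) (h : EquivalentlyEmbedded X Y) : IsBladeTrace Y t B := by
  obtain ⟨φ, h0, hφ⟩ := hX
  obtain ⟨g, hg, rfl⟩ := h
  have hg0 : g.symm 0 = 0 := by
    rw [g.symm_apply_eq]
    obtain ⟨s, hs⟩ := g.surjective 0
    have h1 : g 0 ≤ g s := hg.monotone s.2.1
    rw [hs] at h1
    exact (le_antisymm h1 (g 0).2.1).symm
  refine ⟨g.symm.trans φ, ?_, ?_⟩
  · rw [Homeomorph.trans_apply, hg0, h0]
  · rw [image_image]
    simpa using hφ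

/-- For a fan with a blade having trace `X`, being a `Y`-endpoint generated fan means that `Y` is
equivalently embedded with `X`. -/
theorem isEPG_iff_of_isEPG {X Y : Set I} (hX : IsEPG F X) {t : F} (ht : IsRamificationPoint t)
    (hne : (blades t).Nonempty) : IsEPG F Y ↔ EquivalentlyEmbedded X Y := by
  constructor
  · intro hY
    obtain ⟨B, hB⟩ := hne
    exact IsBladeTrace.equivalentlyEmbedded (hX.2 t ht B hB) (hY.2 t ht B hB)
  · intro h
    exact ⟨hX.1, fun s hs B hB => IsBladeTrace.of_equivalentlyEmbedded (hX.2 s hs B hB) h⟩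

end Invariance

namespace FanModel

variable {F Z : Type*} [TopologicalSpace F] [TopologicalSpace Z] {D : FanModel F Z}
variable [CompactSpace F] [MetrizableSpace F] [TotallySeparatedSpace Z]

/-- In an endpoint-homogeneous fan the trace may be computed on any one blade. -/
theorem isEPG_of_isBladeTrace (hF : IsEndpointHomogeneous F) {X : Set I} {e : F}
    (he : e ∈ endpoints F) (hX : IsBladeTrace X D.top (D.seg D.top e)) : IsEPG F X := by
  refine ⟨D.isFan, fun t ht B hB => ?_⟩
  obtain rfl := (isRamificationPoint_iff (D := D)).mp ht
  obtain ⟨e', he', hB⟩ := hB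
  obtain ⟨h, rfl⟩ := hF e he e' he'
  have htop : h D.top = D.top := (isRamificationPoint_iff (D := D)).mp (ht.image h)
  have h1 := hX.image h
  have h2 := (D.isSegment_seg_top e).image h
  rw [htop] at h1 h2
  rw [eq_seg_of_isSegment hB, ← eq_seg_of_isSegment h2]
  exact h1

end FanModel

/-! ## Positions and heights of the teeth of a comb -/

section Teeth

theorem Fin.sum_Iic_succ {A : Type*} [AddCommMonoid A] {k : ℕ} (f : Fin (k + 1) → A) (i : Fin k) :
    ∑ j ∈ Finset.Iic i.succ, f j = f 0 + ∑ j ∈ Finset.Iic i, f j.succ := by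
  have h : ∀ {l : ℕ} (i : Fin l), Finset.Iic i = Finset.univ.filter (· ≤ i) := by
    intro l i
    ext j
    simp
  rw [h, h, Finset.sum_filter, Finset.sum_filter, Fin.sum_univ_succ]
  simp

/-- Prepending an index acts on positions by one affine contraction, so tuples can be treated by
induction from the front. -/
theorem toothPos_cons {k : ℕ} (m : ℕ+) (n : Fin (k + 1) → ℕ+) :
    toothPos (Fin.cons m n : Fin (k + 2) → ℕ+) = (1 / 3) ^ (m : ℕ) * (2 + toothPos n) := by
  have h0 : Finset.Iic (0 : Fin (k + 2)) = {0} := by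
    ext j
    simp
  rw [toothPos, toothPos, Fin.sum_univ_succ, h0]
  simp only [Fin.sum_Iic_succ, Finset.sum_singleton, Fin.cons_zero, Fin.cons_succ, pow_add,
    ← Finset.mul_sum]
  ring

/-- The summand `0` is kept so that the tooth `(m)` appears as the contraction of the tooth at
position `0`, which plays the role of the empty tuple. -/
theorem toothPos_one (n : Fin 1 → ℕ+) : toothPos n = (1 / 3) ^ (n 0 : ℕ) * (2 + 0) := by
  have h0 : Finset.Iic (0 : Fin 1) = {0} := rfl
  simp [toothPos, h0]
  ring

theorem toothHeight_cons (M : ℝ) (y : ℕ+ → I) {k : ℕ} (m : ℕ+) (n : Fin (k + 1) → ℕ+) :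
    toothHeight M y (Fin.cons m n : Fin (k + 2) → ℕ+) = M ^ (m : ℕ) * y m * toothHeight M y n := by
  rw [toothHeight, toothHeight, Fin.sum_univ_succ, Fin.prod_univ_succ]
  simp only [Fin.castSucc_zero, Fin.cons_zero, ← Fin.succ_castSucc, Fin.cons_succ, pow_add]
  ring

theorem toothHeight_one (M : ℝ) (y : ℕ+ → I) (n : Fin 1 → ℕ+) :
    toothHeight M y n = y (n 0) := by
  simp [toothHeight]

theorem tuple_induction {P : ∀ {k : ℕ}, (Fin (k + 1) → ℕ+) → Prop}
    (one : ∀ n : Fin 1 → ℕ+, P n)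
    (cons : ∀ {k : ℕ} (m : ℕ+) (n : Fin (k + 1) → ℕ+), P n → P (Fin.cons m n : Fin (k + 2) → ℕ+)) :
    ∀ {k : ℕ} (n : Fin (k + 1) → ℕ+), P n := by
  intro k
  induction k with
  | zero => exact one
  | succ k ih =>
    intro n
    rw [← Fin.cons_self_tail n]
    exact cons _ _ (ih _)

theorem mul_mem_cantorSet {x : ℝ} (hx : x ∈ cantorSet) (m : ℕ+) :
    (1 / 3) ^ (m : ℕ) * (2 + x) ∈ cantorSet := by
  have h3 : ∀ {x : ℝ}, x ∈ cantorSet → x / 3 ∈ cantorSet := by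
    intro x hx
    rw [cantorSet_eq_union_halves]
    exact Or.inl ⟨x, hx, rfl⟩
  have h23 : (2 + x) / 3 ∈ cantorSet := by
    rw [cantorSet_eq_union_halves]
    exact Or.inr ⟨x, hx, rfl⟩
  induction m using PNat.recOn with
  | one => convert! h23 using 1; simp; ring
  | succ m ih => convert! h3 ih using 1; rw [PNat.add_coe, PNat.one_coe, pow_succ]; ring

theorem third_pow_pos (m : ℕ) : (0 : ℝ) < (1 / 3) ^ m := by positivity

theorem third_pow_le (m : ℕ+) : (1 / 3 : ℝ) ^ (m : ℕ) ≤ 1 / 3 :=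
  pow_le_of_le_one (by norm_num) (by norm_num) m.ne_zero

theorem toothPos_mem_Ioo {k : ℕ} (n : Fin (k + 1) → ℕ+) : toothPos n ∈ Ioo (0 : ℝ) 1 := by
  induction n using tuple_induction with
  | one n =>
    rw [toothPos_one]
    have := third_pow_pos (n 0)
    have := third_pow_le (n 0)
    constructor <;> linarith
  | cons m n ih =>
    rw [toothPos_cons]
    have := third_pow_pos m
    have := third_pow_le m
    constructor <;> nlinarith [ih.1, ih.2]

theorem toothPos_mem_cantorSet {k : ℕ} (n : Fin (k + 1) → ℕ+) : toothPos n ∈ cantorSet := by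
  induction n using tuple_induction with
  | one n =>
    rw [toothPos_one]
    exact mul_mem_cantorSet zero_mem_cantorSet _
  | cons m n ih =>
    rw [toothPos_cons]
    exact mul_mem_cantorSet ih _

end Teeth

/-- The parameters of a comb: the sequence `y` takes values in `(0, M]`, and `0 < M < 1`. -/
structure CombParam (M : ℝ) (y : ℕ+ → I) : Prop where
  pos : 0 < M
  lt_one : M < 1
  y_pos : ∀ n, 0 < (y n : ℝ)
  y_le : ∀ n, (y n : ℝ) ≤ M

/-- The part of the comb above the base. -/
def teeth (M : ℝ) (y : ℕ+ → I) : Set (ℝ × ℝ) := {z | z ∈ comb M y ∧ 0 < z.2}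

/-- The piecewise linear map of heights taking the comb to the part of it over the `m`-th piece of
the base. -/
noncomputable def scaleHeight (M : ℝ) (y : ℕ+ → I) (m : ℕ+) (v : ℝ) : ℝ :=
  M ^ (m : ℕ) * y m * v + (y m - M ^ (m : ℕ) * y m) / (1 - M) * max 0 (v - M)

/-- The map taking the comb to the part of it over the `m`-th piece of the base. -/
noncomputable def contract (M : ℝ) (y : ℕ+ → I) (m : ℕ+) : ℝ × ℝ → ℝ × ℝ :=
  Prod.map (fun p => (1 / 3) ^ (m : ℕ) * (2 + p)) (scaleHeight M y m)

/-! ### Self-similarity of the comb and compactness of its upper parts. -/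

namespace CombParam

variable {M : ℝ} {y : ℕ+ → I}

theorem mem_teeth {z : ℝ × ℝ} : z ∈ teeth M y ↔ 0 < z.2 ∧ ((z.1 = 0 ∧ z.2 ≤ 1) ∨
    ∃ (k : ℕ) (n : Fin (k + 1) → ℕ+), z.1 = toothPos n ∧ z.2 ≤ toothHeight M y n) := by
  obtain ⟨p, v⟩ := z
  simp only [teeth, comb, mem_ofPred_eq, mem_union, mem_prod, mem_singleton_iff, mem_iUnion, mem_Icc]
  constructor
  · rintro ⟨((h | h) | ⟨k, n, h⟩), hv⟩
    · exact absurd h.2 hv.ne'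
    · exact ⟨hv, Or.inl ⟨h.1, h.2.2⟩⟩
    · exact ⟨hv, Or.inr ⟨k, n, h.1, h.2.2⟩⟩
  · rintro ⟨hv, (h | ⟨k, n, h⟩)⟩
    · exact ⟨Or.inl (Or.inr ⟨h.1, hv.le, h.2⟩), hv⟩
    · exact ⟨Or.inr ⟨k, n, h.1, hv.le, h.2⟩, hv⟩

theorem teeth_down {p v w : ℝ} (h : (p, v) ∈ teeth M y) (hw : 0 < w) (hwv : w ≤ v) :
    (p, w) ∈ teeth M y := by
  rw [mem_teeth] at h ⊢
  exact ⟨hw, h.2.imp (fun h => ⟨h.1, hwv.trans h.2⟩)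
    fun ⟨k, n, h⟩ => ⟨k, n, h.1, hwv.trans h.2⟩⟩

theorem fst_mem_cantorSet {z : ℝ × ℝ} (hz : z ∈ teeth M y) : z.1 ∈ cantorSet := by
  rcases (mem_teeth.mp hz).2 with h | ⟨k, n, h⟩
  · rw [h.1]
    exact zero_mem_cantorSet
  · rw [h.1]
    exact toothPos_mem_cantorSet n

variable (h : CombParam M y)
include h

theorem coeff_pos (m : ℕ+) : 0 < M ^ (m : ℕ) * y m := mul_pos (pow_pos h.pos _) (h.y_pos m)

theorem pow_le (m : ℕ+) : M ^ (m : ℕ) ≤ M := pow_le_of_le_one h.pos.le h.lt_one.le m.ne_zero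

theorem coeff_le (m : ℕ+) : M ^ (m : ℕ) * y m ≤ M * M :=
  mul_le_mul (h.pow_le m) (h.y_le m) (h.y_pos m).le h.pos.le

theorem slope_nonneg (m : ℕ+) : 0 ≤ (y m - M ^ (m : ℕ) * y m) / (1 - M) := by
  refine div_nonneg ?_ (sub_nonneg.mpr h.lt_one.le)
  nlinarith [h.pow_le m, h.y_pos m, h.lt_one]

theorem toothHeight_mem_Ioc {k : ℕ} (n : Fin (k + 1) → ℕ+) : toothHeight M y n ∈ Ioc 0 M := by
  induction n using tuple_induction with
  | one n =>
    rw [toothHeight_one]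
    exact ⟨h.y_pos _, h.y_le _⟩
  | cons m n ih =>
    rw [toothHeight_cons]
    refine ⟨mul_pos (h.coeff_pos m) ih.1, ?_⟩
    calc _ ≤ M * M * M := mul_le_mul (h.coeff_le m) ih.2 ih.1.le (mul_pos h.pos h.pos).le
      _ ≤ M := by nlinarith [h.pos, h.lt_one, mul_pos h.pos h.pos]

-- Teeth indexed by tuples have height at most `M`, and on them prepending `m` multiplies heights by
-- `M ^ m * y m`. The full tooth over `0` must instead go to height `y m`, which is what the extra
-- slope above `M` achieves.
omit h in
theorem scaleHeight_of_le (m : ℕ+) {v : ℝ} (hv : v ≤ M) :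
    scaleHeight M y m v = M ^ (m : ℕ) * y m * v := by
  simp [scaleHeight, hv]

theorem scaleHeight_one (m : ℕ+) : scaleHeight M y m 1 = y m := by
  have := sub_pos.mpr h.lt_one
  rw [scaleHeight, max_eq_right this.le]
  field_simp
  ring

theorem strictMono_scaleHeight (m : ℕ+) : StrictMono (scaleHeight M y m) := by
  intro v w hvw
  have h1 := mul_lt_mul_of_pos_left hvw (h.coeff_pos m)
  have h2 := mul_le_mul_of_nonneg_left (max_le_max_left 0 (sub_le_sub_right hvw.le M))
    (h.slope_nonneg m)
  simp only [scaleHeight]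
  linarith

omit h in
theorem continuous_scaleHeight (m : ℕ+) : Continuous (scaleHeight M y m) := by
  unfold scaleHeight
  fun_prop

theorem scaleHeight_zero (m : ℕ+) : scaleHeight M y m 0 = 0 := by
  rw [scaleHeight_of_le m h.pos.le, mul_zero]

theorem scaleHeight_pos (m : ℕ+) {v : ℝ} (hv : 0 < v) : 0 < scaleHeight M y m v := by
  rw [← h.scaleHeight_zero m]
  exact h.strictMono_scaleHeight m hv

/-- The function is convex, vanishes at `0` and takes the value `y m ≤ M` at `1`, so it lies below
the chord. This uniform shrinking drives the induction in `isCompact_teeth_ge`. -/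
theorem scaleHeight_le (m : ℕ+) {v : ℝ} (hv : 0 < v) (hv1 : v ≤ 1) :
    scaleHeight M y m v ≤ M * v := by
  have hc := h.coeff_le m
  have hcp := h.coeff_pos m
  rcases le_total v M with hvM | hvM
  · rw [scaleHeight_of_le m hvM]
    nlinarith [h.pos, h.lt_one, mul_pos h.pos hv]
  · have h1M := sub_pos.mpr h.lt_one
    rw [scaleHeight, max_eq_right (sub_nonneg.mpr hvM), div_mul_eq_mul_div, ← le_sub_iff_add_le',
      div_le_iff₀ h1M]
    have hcM : M ^ (m : ℕ) * y m ≤ M := by nlinarith [h.pos, h.lt_one]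
    nlinarith [mul_nonneg (sub_nonneg.mpr hvM) (sub_nonneg.mpr (h.y_le m)),
      mul_nonneg (mul_nonneg h.pos.le (sub_nonneg.mpr hv1)) (sub_nonneg.mpr hcM)]

theorem exists_scaleHeight (m : ℕ+) {v s : ℝ} (hv : 0 ≤ v) (hs : 0 < s)
    (hsv : s ≤ scaleHeight M y m v) : ∃ w, 0 < w ∧ w ≤ v ∧ scaleHeight M y m w = s := by
  obtain ⟨w, ⟨hw0, hwv⟩, rfl⟩ := intermediate_value_Icc hv
    (continuous_scaleHeight (M := M) (y := y) m).continuousOn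
    (show s ∈ Icc _ _ from ⟨by rw [h.scaleHeight_zero]; exact hs.le, hsv⟩)
  refine ⟨w, lt_of_le_of_ne hw0 ?_, hwv, rfl⟩
  rintro rfl
  rw [h.scaleHeight_zero] at hs
  exact hs.false

theorem isEmbedding_contract (m : ℕ+) : IsEmbedding (contract M y m) := by
  have h1 : IsEmbedding (fun p : ℝ => (1 / 3 : ℝ) ^ (m : ℕ) * (2 + p)) :=
    ((Homeomorph.addLeft (2 : ℝ)).trans
      (Homeomorph.mulLeft₀ ((1 / 3 : ℝ) ^ (m : ℕ)) (third_pow_pos m).ne')).isEmbedding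
  refine h1.prodMap ((h.strictMono_scaleHeight m).isEmbedding_of_ordConnected ?_)
  rw [← image_univ]
  exact isPreconnected_iff_ordConnected.mp
    (isPreconnected_univ.image _ (continuous_scaleHeight m).continuousOn)

theorem snd_le_one {z : ℝ × ℝ} (hz : z ∈ teeth M y) : z.2 ≤ 1 := by
  rcases (mem_teeth.mp hz).2 with h' | ⟨k, n, h'⟩
  · exact h'.2
  · exact h'.2.trans ((h.toothHeight_mem_Ioc n).2.trans h.lt_one.le)

omit h in
theorem fst_mem_Ico {z : ℝ × ℝ} (hz : z ∈ teeth M y) : z.1 ∈ Ico (0 : ℝ) 1 := by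
  rcases (mem_teeth.mp hz).2 with h' | ⟨k, n, h'⟩
  · rw [h'.1]; simp
  · rw [h'.1]; exact Ioo_subset_Ico_self (toothPos_mem_Ioo n)

theorem contract_mem {z : ℝ × ℝ} (hz : z ∈ teeth M y) (m : ℕ+) : contract M y m z ∈ teeth M y := by
  obtain ⟨p, v⟩ := z
  obtain ⟨hv, h' | ⟨k, n, h'⟩⟩ := mem_teeth.mp hz
  · refine mem_teeth.mpr ⟨h.scaleHeight_pos m hv, Or.inr ⟨0, fun _ => m, ?_, ?_⟩⟩
    · obtain ⟨rfl, -⟩ := h'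
      rw [toothPos_one]
      rfl
    · rw [toothHeight_one, ← h.scaleHeight_one]
      exact (h.strictMono_scaleHeight m).monotone h'.2
  · refine mem_teeth.mpr ⟨h.scaleHeight_pos m hv, Or.inr ⟨k + 1, Fin.cons m n, ?_, ?_⟩⟩
    · obtain ⟨rfl, -⟩ := h'
      rw [toothPos_cons]
      rfl
    · rw [toothHeight_cons, ← scaleHeight_of_le m (h.toothHeight_mem_Ioc n).2]
      exact (h.strictMono_scaleHeight m).monotone h'.2

/-- A one-index tooth comes from the tooth over `0`, and a longer tuple from its tail. So the comb
above its base is the tooth over `0` together with its contracted copies. -/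
theorem exists_contract {z : ℝ × ℝ} (hz : z ∈ teeth M y) (hz0 : z.1 ≠ 0) :
    ∃ m, ∃ w ∈ teeth M y, contract M y m w = z := by
  obtain ⟨p, v⟩ := z
  obtain ⟨hv, h' | ⟨k, n, h'⟩⟩ := mem_teeth.mp hz
  · exact absurd h'.1 hz0
  obtain ⟨rfl, hvn⟩ := h'
  cases k with
  | zero =>
    rw [toothHeight_one, ← h.scaleHeight_one] at hvn
    obtain ⟨w, hw0, hw1, rfl⟩ := h.exists_scaleHeight (n 0) zero_le_one hv hvn
    refine ⟨n 0, (0, w), mem_teeth.mpr ⟨hw0, Or.inl ⟨rfl, hw1⟩⟩, ?_⟩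
    rw [toothPos_one]
    rfl
  | succ k =>
    rw [← Fin.cons_self_tail n, toothHeight_cons,
      ← scaleHeight_of_le _ (h.toothHeight_mem_Ioc _).2] at hvn
    obtain ⟨w, hw0, hw1, rfl⟩ := h.exists_scaleHeight (n 0) (h.toothHeight_mem_Ioc _).1.le hv hvn
    refine ⟨n 0, (toothPos (Fin.tail n), w), mem_teeth.mpr ⟨hw0, Or.inr ⟨k, _, rfl, hw1⟩⟩, ?_⟩
    conv_rhs => rw [← Fin.cons_self_tail n]
    rw [toothPos_cons]
    rfl

omit h in
theorem contract_fst_mem {z : ℝ × ℝ} (hz : z ∈ teeth M y) (m : ℕ+) :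
    2 * (1 / 3) ^ (m : ℕ) ≤ (contract M y m z).1 ∧
      (contract M y m z).1 ≤ 3 * (1 / 3) ^ (m : ℕ) := by
  have := fst_mem_Ico hz
  have h3 := third_pow_pos m
  simp only [contract, Prod.map_fst]
  constructor <;> nlinarith [this.1, this.2]

/-- The `m`-th piece lies over `[2·3^(-m), 3·3^(-m)]`, while its neighbours end at `3^(-m)` and
start at `6·3^(-m)`. The bounds `3/2` and `4` are arbitrary choices inside the gaps. -/
theorem mem_image_contract {z : ℝ × ℝ} (hz : z ∈ teeth M y) {m : ℕ+}
    (h1 : 3 / 2 * (1 / 3) ^ (m : ℕ) < z.1) (h2 : z.1 < 4 * (1 / 3) ^ (m : ℕ)) :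
    z ∈ contract M y m '' teeth M y := by
  have h3 := third_pow_pos m
  obtain ⟨m', w, hw, rfl⟩ := h.exists_contract hz (by linarith)
  have hm := contract_fst_mem hw m'
  suffices m' = m by subst this; exact mem_image_of_mem _ hw
  have key : ∀ i j : ℕ+, i < j → (1 / 3 : ℝ) ^ (j : ℕ) ≤ (1 / 3) ^ (i : ℕ) / 3 := by
    intro i j hij
    have : (1 / 3 : ℝ) ^ (j : ℕ) ≤ (1 / 3) ^ ((i : ℕ) + 1) :=
      pow_le_pow_of_le_one (by norm_num) (by norm_num) hij
    rw [pow_succ] at this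
    linarith
  rcases lt_trichotomy m' m with hlt | heq | hlt
  · have := key _ _ hlt
    linarith [hm.1]
  · exact heq
  · have := key _ _ hlt
    linarith [hm.2]

/-- Induction on `N` with `M ^ N < ε`: points of height at least `ε` in a piece come from points of
height at least `ε / M`, so each truncated piece is compact. The pieces accumulate only over `0`,
where the comb already has the full tooth. For `N = 0` nothing is that high. -/
theorem isCompact_teeth_ge {ε : ℝ} (hε : 0 < ε) : IsCompact (teeth M y ∩ {z | ε ≤ z.2}) := by
  suffices H : ∀ N : ℕ, ∀ ε : ℝ, 0 < ε → M ^ N < ε → IsCompact (teeth M y ∩ {z | ε ≤ z.2}) by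
    obtain ⟨N, hN⟩ := exists_pow_lt_of_lt_one hε h.lt_one
    exact H N ε hε hN
  intro N
  induction N with
  | zero =>
    intro ε _ hε1
    convert! isCompact_empty
    rw [eq_empty_iff_forall_notMem]
    rintro z ⟨hz, hz' : ε ≤ z.2⟩
    have := h.snd_le_one hz
    simp at hε1
    linarith
  | succ N ih =>
    intro ε hε hN
    have hεM : M ^ N < ε / M := by
      rw [lt_div_iff₀ h.pos, ← pow_succ]
      exact hN
    let K : ℕ+ → Set (ℝ × ℝ) := fun m =>
      contract M y m '' (teeth M y ∩ {z | ε / M ≤ z.2}) ∩ {z | ε ≤ z.2}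
    have hcl : IsClosed {z : ℝ × ℝ | ε ≤ z.2} := isClosed_le continuous_const continuous_snd
    have hK : ∀ m, IsClosed (K m) := fun m =>
      (((ih _ (div_pos hε h.pos) hεM).image (h.isEmbedding_contract m).continuous).isClosed).inter hcl
    have hKfst : ∀ m, ∀ z ∈ K m, z.1 ≤ 3 * (1 / 3) ^ (m : ℕ) := by
      rintro m _ ⟨⟨w, hw, rfl⟩, -⟩
      exact (contract_fst_mem hw.1 m).2
    have heq : teeth M y ∩ {z | ε ≤ z.2} = {0} ×ˢ Icc ε 1 ∪ ⋃ m, K m := by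
      ext z
      constructor
      · rintro ⟨hz, hz' : ε ≤ z.2⟩
        by_cases hz0 : z.1 = 0
        · exact Or.inl ⟨hz0, hz', h.snd_le_one hz⟩
        · obtain ⟨m, w, hw, rfl⟩ := h.exists_contract hz hz0
          refine Or.inr (mem_iUnion.mpr ⟨m, ⟨w, ⟨hw, ?_⟩, rfl⟩, hz'⟩)
          show ε / M ≤ w.2
          rw [div_le_iff₀ h.pos, mul_comm]
          exact le_trans hz' (h.scaleHeight_le m (mem_teeth.mp hw).1 (h.snd_le_one hw))
      · rintro (⟨hz0, hz, hz1⟩ | hz)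
        · exact ⟨mem_teeth.mpr ⟨hε.trans_le hz, Or.inl ⟨hz0, hz1⟩⟩, hz⟩
        · obtain ⟨m, ⟨w, hw, rfl⟩, hz⟩ := mem_iUnion.mp hz
          exact ⟨h.contract_mem hw.1 m, hz⟩
    have hbox : teeth M y ∩ {z | ε ≤ z.2} ⊆ Icc 0 1 ×ˢ Icc ε 1 := by
      rintro z ⟨hz, hz'⟩
      exact ⟨Ico_subset_Icc_self (fst_mem_Ico hz), hz', h.snd_le_one hz⟩
    refine (isCompact_Icc.prod isCompact_Icc).of_isClosed_subset (isClosed_of_closure_subset ?_) hbox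
    intro z hz
    have hzbox : z ∈ Icc (0 : ℝ) 1 ×ˢ Icc ε 1 :=
      closure_minimal hbox (isClosed_Icc.prod isClosed_Icc) hz
    rw [heq] at hz ⊢
    by_cases hz0 : z.1 = 0
    · exact Or.inl ⟨hz0, hzbox.2⟩
    have hzpos : 0 < z.1 := lt_of_le_of_ne hzbox.1.1 (Ne.symm hz0)
    -- Pieces of index at least `N` lie over `[0, 3·3^(-N)]`, hence to the left of `z.1 / 2`; only
    -- finitely many pieces matter near `z`.
    obtain ⟨N, hN⟩ := exists_pow_lt_of_lt_one (show 0 < z.1 / 6 by linarith)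
      (show (1 / 3 : ℝ) < 1 by norm_num)
    have hopen : IsOpen {w : ℝ × ℝ | z.1 / 2 < w.1} := isOpen_lt continuous_const continuous_fst
    have h1 := hopen.inter_closure ⟨show z.1 / 2 < z.1 by linarith, hz⟩
    have hfin : {m : ℕ+ | (m : ℕ) < N}.Finite :=
      (Set.finite_lt_nat N).preimage PNat.coe_injective.injOn
    have h2 : IsClosed (⋃ m ∈ {m : ℕ+ | (m : ℕ) < N}, K m) :=
      hfin.isClosed_biUnion fun m _ => hK m
    have h3 := closure_minimal (s := {w : ℝ × ℝ | z.1 / 2 < w.1} ∩ ({0} ×ˢ Icc ε 1 ∪ ⋃ m, K m)) ?_ h2 h1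
    · obtain ⟨m, -, hm⟩ := mem_iUnion₂.mp h3
      exact Or.inr (mem_iUnion.mpr ⟨m, hm⟩)
    · rintro w ⟨hw : z.1 / 2 < w.1, hw' | hw'⟩
      · have : w.1 = 0 := hw'.1
        linarith
      · obtain ⟨m, hm⟩ := mem_iUnion.mp hw'
        refine mem_iUnion₂.mpr ⟨m, ?_, hm⟩
        by_contra hmN
        have h4 : (1 / 3 : ℝ) ^ (m : ℕ) ≤ (1 / 3) ^ N :=
          pow_le_pow_of_le_one (by norm_num) (by norm_num) (not_lt.mp hmN)
        linarith [hKfst m w hm]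

end CombParam

/-! ## Swapping two clopen copies of a space -/

section Swap

variable {U L : Type*} [TopologicalSpace U] [TopologicalSpace L]

open Classical in
/-- Two disjoint clopen copies of a space can be swapped by a homeomorphism. -/
theorem exists_homeomorph_swap {i j : U → L} (hi : IsOpenEmbedding i) (hj : IsOpenEmbedding j)
    (hi' : IsClosed (range i)) (hj' : IsClosed (range j)) (hij : ∀ u v, i u ≠ j v) :
    ∃ Φ : L ≃ₜ L, ∀ u, Φ (i u) = j u := by
  let Φ : L → L := fun x => if h : ∃ u, i u = x then j h.choose else
    if h : ∃ u, j u = x then i h.choose else x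
  have h1 : ∀ u, Φ (i u) = j u := by
    intro u
    have h : ∃ u', i u' = i u := ⟨u, rfl⟩
    simp only [Φ, dif_pos h]
    rw [hi.injective h.choose_spec]
  have h2 : ∀ u, Φ (j u) = i u := by
    intro u
    have h : ∃ u', j u' = j u := ⟨u, rfl⟩
    have h' : ¬∃ u', i u' = j u := fun ⟨u', h'⟩ => hij _ _ h'
    simp only [Φ, dif_neg h', dif_pos h]
    rw [hj.injective h.choose_spec]
  have h3 : ∀ x, x ∉ range i → x ∉ range j → Φ x = x := by
    intro x hx hx'
    exact (dif_neg hx).trans (dif_neg hx')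
  have hinv : Function.Involutive Φ := by
    intro x
    by_cases hx : x ∈ range i
    · obtain ⟨u, rfl⟩ := hx
      rw [h1, h2]
    by_cases hx' : x ∈ range j
    · obtain ⟨u, rfl⟩ := hx'
      rw [h2, h1]
    rw [h3 x hx hx', h3 x hx hx']
  have hc : Continuous Φ := by
    rw [continuous_iff_continuousAt]
    intro x
    by_cases hx : x ∈ range i
    · obtain ⟨u, rfl⟩ := hx
      rw [← hi.continuousAt_iff, show Φ ∘ i = j from funext h1]
      exact hj.continuous.continuousAt
    by_cases hx' : x ∈ range j
    · obtain ⟨u, rfl⟩ := hx'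
      rw [← hj.continuousAt_iff, show Φ ∘ j = i from funext h2]
      exact hi.continuous.continuousAt
    have : Φ =ᶠ[𝓝 x] id := by
      filter_upwards [hi'.isOpen_compl.mem_nhds hx, hj'.isOpen_compl.mem_nhds hx'] with z hz hz'
      exact h3 z hz hz'
    exact continuousAt_id.congr this.symm
  exact ⟨⟨hinv.toPerm, hc, hc⟩, h1⟩

end Swap

/-! ## The Cantor set -/

instance compactSpace_cantorSet : CompactSpace cantorSet :=
  isCompact_iff_compactSpace.mp isCompact_cantorSet

instance totallyDisconnectedSpace_cantorSet : TotallyDisconnectedSpace cantorSet := by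
  refine ⟨fun S _ hS x hx y hy => cantorSetHomeomorphNatToBool.injective ?_⟩
  exact (hS.image _ cantorSetHomeomorphNatToBool.continuous.continuousOn).subsingleton
    (mem_image_of_mem _ hx) (mem_image_of_mem _ hy)

/-- Two points of the Cantor set are interchanged by a homeomorphism, which moreover maps some
clopen set containing one of them to its complement. -/
theorem exists_homeomorph_cantorSet {c d : cantorSet} (hcd : c ≠ d) :
    ∃ (g : cantorSet ≃ₜ cantorSet) (W : Set cantorSet), g c = d ∧ IsClopen W ∧ c ∈ W ∧
      ∀ x ∈ W, g x ∉ W := by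
  let e := cantorSetHomeomorphNatToBool
  obtain ⟨n, hn⟩ : ∃ n, e c n ≠ e d n := by
    by_contra! h
    exact hcd (e.injective (funext h))
  -- Translation in the group of binary sequences by the difference of `c` and `d`. It is an
  -- involution flipping coordinate `n`, so it moves the cylinder given by that coordinate off
  -- itself.
  let f : (ℕ → Bool) → (ℕ → Bool) := fun x i => xor (x i) (xor (e c i) (e d i))
  have hf : Function.Involutive f := by
    intro x
    funext i
    simp [f]
  have hfc : Continuous f := by
    refine continuous_pi fun i => ?_
    exact (continuous_of_discreteTopology (f := fun b : Bool => xor b (xor (e c i) (e d i)))).comp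
      (continuous_apply i)
  let g : (ℕ → Bool) ≃ₜ (ℕ → Bool) := ⟨hf.toPerm, hfc, hfc⟩
  refine ⟨e.trans (g.trans e.symm), (fun x => e x n) ⁻¹' {e c n}, ?_, ?_, rfl, ?_⟩
  · have : f (e c) = e d := by
      funext i
      simp [f]
    show e.symm (f (e c)) = d
    rw [this, e.symm_apply_apply]
  · exact (isClopen_discrete _).preimage ((continuous_apply n).comp e.continuous)
  · intro x hx hx'
    have h1 : e x n = e c n := hx
    have h2 : e (e.symm (f (e x))) n = e c n := hx'
    rw [e.apply_symm_apply] at h2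
    simp only [f, h1] at h2
    cases hc : e c n <;> cases hd : e d n <;> simp_all

theorem exists_ne_cantorSet (c d : cantorSet) : ∃ c' : cantorSet, c' ≠ c ∧ c' ≠ d := by
  let e := cantorSetHomeomorphNatToBool
  -- A diagonal choice: coordinate `0` disagrees with `c` and coordinate `1` with `d`.
  refine ⟨e.symm fun n => if n = 0 then !(e c 0) else !(e d 1), ?_, ?_⟩
  · intro h
    rw [e.symm_apply_eq] at h
    have := congrFun h 0
    simp at this
  · intro h
    rw [e.symm_apply_eq] at h
    have := congrFun h 1
    simp at this

theorem tendsto_third_pow : Tendsto (fun m : ℕ+ => (1 / 3 : ℝ) ^ (m : ℕ)) cofinite (𝓝 0) := by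
  have h1 : Tendsto (fun n : ℕ => (1 / 3 : ℝ) ^ n) cofinite (𝓝 0) := by
    rw [Nat.cofinite_eq_atTop]
    exact tendsto_pow_atTop_nhds_zero_of_lt_one (by norm_num) (by norm_num)
  exact h1.comp PNat.coe_injective.tendsto_cofinite

/-! ## Homogeneity of the Cantor multiple of a comb -/

namespace CombParam

variable {M : ℝ} {y : ℕ+ → I}

/-- `x` can be moved to `x'` by a homeomorphism of the product of the comb, without its base, with
the Cantor set. -/
def Movable (x x' : teeth M y × cantorSet) : Prop :=
  ∃ Φ : (teeth M y × cantorSet) ≃ₜ (teeth M y × cantorSet), Φ x = x'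

theorem Movable.symm {x x' : teeth M y × cantorSet} (h : Movable x x') : Movable x' x := by
  obtain ⟨Φ, rfl⟩ := h
  exact ⟨Φ.symm, Φ.symm_apply_apply x⟩

theorem Movable.trans {x x' x'' : teeth M y × cantorSet} (h : Movable x x') (h' : Movable x' x'') :
    Movable x x'' := by
  obtain ⟨Φ, rfl⟩ := h
  obtain ⟨Ψ, rfl⟩ := h'
  exact ⟨Φ.trans Ψ, rfl⟩

theorem movable_cantorSet (w : teeth M y) (c d : cantorSet) : Movable (w, c) (w, d) := by
  by_cases hcd : c = d
  · exact ⟨Homeomorph.refl _, by rw [hcd]; rfl⟩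
  · obtain ⟨g, -, hg, -⟩ := exists_homeomorph_cantorSet hcd
    exact ⟨(Homeomorph.refl _).prodCongr g, by simp [hg]⟩

variable (h : CombParam M y)
include h

/-- The self-embedding of the comb, without its base, onto its part over the `m`-th piece. -/
noncomputable def contractTeeth (m : ℕ+) (w : teeth M y) : teeth M y := ⟨contract M y m w, h.contract_mem w.2 m⟩

theorem isEmbedding_contractTeeth (m : ℕ+) : IsEmbedding (h.contractTeeth m) := by
  refine IsEmbedding.subtypeVal.of_comp_iff.mp ?_
  exact (h.isEmbedding_contract m).comp IsEmbedding.subtypeVal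

theorem mem_range_contractTeeth_iff (m : ℕ+) (z : teeth M y) : z ∈ range (h.contractTeeth m) ↔
    (z : ℝ × ℝ) ∈ contract M y m '' teeth M y := by
  constructor
  · rintro ⟨w, rfl⟩
    exact mem_image_of_mem _ w.2
  · rintro ⟨w, hw, hwz⟩
    exact ⟨⟨w, hw⟩, Subtype.ext hwz⟩

/-- The gaps between pieces let the same set be cut out by a closed and by an open interval of
positions. -/
theorem isClopen_range_contractTeeth (m : ℕ+) : IsClopen (range (h.contractTeeth m)) := by
  have hfst : Continuous fun z : teeth M y => (z : ℝ × ℝ).1 :=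
    continuous_fst.comp continuous_subtype_val
  have h3 := third_pow_pos m
  constructor
  · have : range (h.contractTeeth m) = (fun z : teeth M y => (z : ℝ × ℝ).1) ⁻¹'
        Icc (2 * (1 / 3) ^ (m : ℕ)) (3 * (1 / 3) ^ (m : ℕ)) := by
      ext z
      rw [mem_range_contractTeeth_iff]
      constructor
      · rintro ⟨w, hw, hwz⟩
        rw [mem_preimage, ← hwz]
        exact contract_fst_mem hw m
      · rintro ⟨h1, h2⟩
        exact h.mem_image_contract z.2 (by linarith) (by linarith)
    rw [this]
    exact isClosed_Icc.preimage hfst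
  · have : range (h.contractTeeth m) = (fun z : teeth M y => (z : ℝ × ℝ).1) ⁻¹'
        Ioo (3 / 2 * (1 / 3) ^ (m : ℕ)) (4 * (1 / 3) ^ (m : ℕ)) := by
      ext z
      rw [mem_range_contractTeeth_iff]
      constructor
      · rintro ⟨w, hw, hwz⟩
        rw [mem_preimage, ← hwz]
        have := contract_fst_mem hw m
        constructor <;> linarith
      · rintro ⟨h1, h2⟩
        exact h.mem_image_contract z.2 h1 h2
    rw [this]
    exact isOpen_Ioo.preimage hfst

/-- The contraction is only an embedding onto a clopen part, but the Cantor factor leaves room to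
extend it. It maps `teeth × W` onto a clopen set with Cantor coordinates in `g '' W`, disjoint from
`W`, so the two copies can be swapped and the rest fixed. -/
theorem movable_contractTeeth (m : ℕ+) (w : teeth M y) (c d : cantorSet) :
    Movable (w, c) (h.contractTeeth m w, d) := by
  -- The Cantor coordinate is first changed to some `c' ≠ d`, since `c` may equal `d` and only
  -- distinct points have such a displaced neighbourhood.
  obtain ⟨c', hc', -⟩ := exists_ne_cantorSet d d
  refine (movable_cantorSet w c c').trans ?_
  obtain ⟨g, W, hg, hW, hcW, hgW⟩ := exists_homeomorph_cantorSet hc'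
  let i : teeth M y × W → teeth M y × cantorSet := Prod.map id Subtype.val
  let j : teeth M y × W → teeth M y × cantorSet := Prod.map (h.contractTeeth m) (g ∘ Subtype.val)
  have hr := h.isClopen_range_contractTeeth m
  have hgr : range (g ∘ (Subtype.val : W → cantorSet)) = g '' W := by
    rw [range_comp, Subtype.range_val]
  have hi : IsOpenEmbedding i := IsOpenEmbedding.id.prodMap hW.isOpen.isOpenEmbedding_subtypeVal
  have hj : IsOpenEmbedding j := IsOpenEmbedding.prodMap ⟨h.isEmbedding_contractTeeth m, hr.isOpen⟩
    (g.isOpenEmbedding.comp hW.isOpen.isOpenEmbedding_subtypeVal)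
  have hi' : IsClosed (range i) := by
    rw [range_prodMap, range_id, Subtype.range_val]
    exact isClosed_univ.prod hW.isClosed
  have hj' : IsClosed (range j) := by
    rw [range_prodMap, hgr]
    exact hr.isClosed.prod (g.isClosedMap _ hW.isClosed)
  obtain ⟨Φ, hΦ⟩ := exists_homeomorph_swap hi hj hi' hj' (by
    rintro ⟨u, a⟩ ⟨v, b⟩ huv
    have h1 : (a : cantorSet) = g b := congrArg Prod.snd huv
    exact hgW b b.2 (h1 ▸ a.2))
  refine ⟨Φ, ?_⟩
  have := hΦ (w, ⟨c', hcW⟩)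
  simpa [i, j, hg] using this

omit h in
theorem base_mem : ((0, 1) : ℝ × ℝ) ∈ teeth M y := mem_teeth.mpr ⟨zero_lt_one, Or.inl ⟨rfl, le_rfl⟩⟩

theorem tip_mem {k : ℕ} (n : Fin (k + 1) → ℕ+) :
    (toothPos n, toothHeight M y n) ∈ teeth M y :=
  mem_teeth.mpr ⟨(h.toothHeight_mem_Ioc n).1, Or.inr ⟨k, n, rfl, le_rfl⟩⟩

/-- Contraction by `m` carries the tip `(0, 1)` to the tip of `(m)` and the tip of `n` to that of
`(m, n)`. -/
theorem movable_tip {k : ℕ} (n : Fin (k + 1) → ℕ+) (c d : cantorSet) :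
    Movable ((⟨(0, 1), base_mem⟩, c) : teeth M y × cantorSet) (⟨_, h.tip_mem n⟩, d) := by
  induction n using tuple_induction with
  | one n =>
    convert! h.movable_contractTeeth (n 0) ⟨(0, 1), base_mem⟩ c d using 2
    refine Subtype.ext (Prod.ext ?_ ?_)
    · exact toothPos_one n
    · exact (toothHeight_one M y n).trans (h.scaleHeight_one _).symm
  | cons m n ih =>
    refine ih.trans ?_
    convert! h.movable_contractTeeth m ⟨_, h.tip_mem n⟩ d d using 2
    refine Subtype.ext (Prod.ext ?_ ?_)
    · exact toothPos_cons m n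
    · refine (toothHeight_cons M y m n).trans ?_
      exact (scaleHeight_of_le m (h.toothHeight_mem_Ioc n).2).symm

end CombParam

/-! ## The Cantor multiple of the fan of a comb as a fan -/

/-- The Cantor multiple of the fan of a comb, as a one-point compactification. -/
abbrev CombMultiple (M : ℝ) (y : ℕ+ → I) : Type := OnePoint (teeth M y × cantorSet)

namespace CombParam

variable {M : ℝ} {y : ℕ+ → I} (h : CombParam M y)
include h

theorem tendsto_snd_coclosedCompact :
    Tendsto (fun p : teeth M y × cantorSet => (p.1 : ℝ × ℝ).2) (coclosedCompact _) (𝓝 0) := by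
  have hc : Continuous fun p : teeth M y × cantorSet => (p.1 : ℝ × ℝ).2 :=
    continuous_snd.comp (continuous_subtype_val.comp continuous_fst)
  rw [Metric.tendsto_nhds]
  intro ε hε
  refine hasBasis_coclosedCompact.mem_iff.mpr
    ⟨{p | ε ≤ (p.1 : ℝ × ℝ).2}, ⟨isClosed_le continuous_const hc, ?_⟩, ?_⟩
  · have h1 : IsCompact {w : teeth M y | ε ≤ (w : ℝ × ℝ).2} := by
      rw [Subtype.isCompact_iff]
      convert! h.isCompact_teeth_ge hε using 1
      ext z
      simp [and_comm]
    convert! h1.prod (isCompact_univ (X := cantorSet)) using 1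
    ext p
    simp
  · intro p hp
    have hp' : (p.1 : ℝ × ℝ).2 < ε := not_le.mp hp
    show dist _ _ < ε
    rw [Real.dist_0_eq_abs, abs_of_pos (mem_teeth.mp p.1.2).1]
    exact hp'

/-- The height tends to `0` at infinity because its superlevel sets are compact, so anything bounded
by the height extends by `0`. -/
theorem continuous_elim {E : Type*} [NormedAddCommGroup E] {f : teeth M y × cantorSet → E}
    (hf : Continuous f) (hle : ∀ p, ‖f p‖ ≤ (p.1 : ℝ × ℝ).2) :
    Continuous fun x : CombMultiple M y => x.elim 0 f := by
  rw [OnePoint.continuous_iff]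
  exact ⟨squeeze_zero_norm hle h.tendsto_snd_coclosedCompact, hf⟩

/-- The cone coordinates `(v, v * u, v * c)`, with `v` the height, `u` the position and `c` the
Cantor coordinate, embed the compactification in three-space. -/
theorem metrizableSpace : MetrizableSpace (CombMultiple M y) := by
  let f : teeth M y × cantorSet → ℝ × ℝ × ℝ := fun p =>
    ((p.1 : ℝ × ℝ).2, (p.1 : ℝ × ℝ).2 * (p.1 : ℝ × ℝ).1, (p.1 : ℝ × ℝ).2 * p.2)
  have hc : Continuous fun x : CombMultiple M y => x.elim 0 f := by
    refine h.continuous_elim (by fun_prop) fun p => ?_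
    have hv := (mem_teeth.mp p.1.2).1
    have hp := fst_mem_Ico p.1.2
    have hk := cantorSet_subset_unitInterval p.2.2
    simp only [f, norm_prod_le_iff, Real.norm_eq_abs]
    refine ⟨(abs_of_pos hv).le, ?_, ?_⟩
    · rw [abs_of_nonneg (mul_nonneg hv.le hp.1)]
      exact mul_le_of_le_one_right hv.le hp.2.le
    · rw [abs_of_nonneg (mul_nonneg hv.le hk.1)]
      exact mul_le_of_le_one_right hv.le hk.2
  have hi : Function.Injective fun x : CombMultiple M y => x.elim 0 f := by
    intro a b hab
    induction a using OnePoint.rec with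
    | infty =>
      induction b using OnePoint.rec with
      | infty => rfl
      | coe b => exact absurd (congrArg Prod.fst hab) (mem_teeth.mp b.1.2).1.ne
    | coe a =>
      have ha := (mem_teeth.mp a.1.2).1
      induction b using OnePoint.rec with
      | infty => exact absurd (congrArg Prod.fst hab) ha.ne'
      | coe b =>
        have h1 : (a.1 : ℝ × ℝ).2 = (b.1 : ℝ × ℝ).2 := congrArg Prod.fst hab
        have h2 : (a.1 : ℝ × ℝ).2 * (a.1 : ℝ × ℝ).1 = (b.1 : ℝ × ℝ).2 * (b.1 : ℝ × ℝ).1 :=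
          congrArg (fun p => p.2.1) hab
        have h3 : (a.1 : ℝ × ℝ).2 * (a.2 : ℝ) = (b.1 : ℝ × ℝ).2 * (b.2 : ℝ) :=
          congrArg (fun p => p.2.2) hab
        rw [← h1] at h2 h3
        have h2' := mul_left_cancel₀ ha.ne' h2
        have h3' := mul_left_cancel₀ ha.ne' h3
        rw [Prod.ext (Subtype.ext (Prod.ext h2' h1)) (Subtype.ext h3')]
  exact (hc.isClosedEmbedding hi).isEmbedding.metrizableSpace

/-- The presentation of the Cantor multiple of the fan of a comb. -/
noncomputable def model : FanModel (CombMultiple M y) (cantorSet × cantorSet) where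
  top := OnePoint.infty
  height x := x.elim 0 fun p => (p.1 : ℝ × ℝ).2
  -- The value at infinity is arbitrary: every requirement on fibres concerns points off the top.
  fibre x := x.elim (⟨0, zero_mem_cantorSet⟩, ⟨0, zero_mem_cantorSet⟩)
    fun p => (⟨(p.1 : ℝ × ℝ).1, fst_mem_cantorSet p.1.2⟩, p.2)
  continuous_height := h.continuous_elim (by fun_prop) fun p => by
    rw [Real.norm_eq_abs, abs_of_pos (mem_teeth.mp p.1.2).1]
  height_nonneg x := by
    induction x using OnePoint.rec with
    | infty => exact le_rfl
    | coe p => exact (mem_teeth.mp p.1.2).1.le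
  height_eq_zero x := by
    induction x using OnePoint.rec with
    | infty => exact ⟨fun _ => rfl, fun _ => rfl⟩
    | coe p => exact ⟨fun h' => absurd h' (mem_teeth.mp p.1.2).1.ne',
        fun h' => absurd h' (OnePoint.coe_ne_infty p)⟩
  continuousOn_fibre := by
    intro x hx
    induction x using OnePoint.rec with
    | infty => exact absurd rfl hx
    | coe p =>
      refine (OnePoint.continuousAt_coe.mpr (Continuous.continuousAt ?_)).continuousWithinAt
      exact (Continuous.subtype_mk (by fun_prop) _).prodMk continuous_snd
  ext a b ha hb h1 h2 := by
    induction a using OnePoint.rec with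
    | infty => exact absurd rfl ha
    | coe a =>
      induction b using OnePoint.rec with
      | infty => exact absurd rfl hb
      | coe b =>
        have h3 : (a.1 : ℝ × ℝ).1 = (b.1 : ℝ × ℝ).1 := congrArg (fun q => (q.1 : ℝ)) h1
        have h4 : a.2 = b.2 := congrArg (fun q : cantorSet × cantorSet => q.2) h1
        rw [Prod.ext (Subtype.ext (Prod.ext h3 h2)) h4]
  exists_of_le x s hs hsx := by
    induction x using OnePoint.rec with
    | infty => exact absurd hs (not_lt.mpr hsx)
    | coe p =>
      exact ⟨((⟨((p.1 : ℝ × ℝ).1, s), teeth_down p.1.2 hs hsx⟩, p.2) : teeth M y × cantorSet),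
        rfl, rfl⟩
  exists_three := by
    let k₀ : cantorSet := ⟨0, zero_mem_cantorSet⟩
    obtain ⟨k₁, h1, -⟩ := exists_ne_cantorSet k₀ k₀
    obtain ⟨k₂, h2, h2'⟩ := exists_ne_cantorSet k₀ k₁
    let q : cantorSet → CombMultiple M y :=
      fun k => ((⟨(0, 1), base_mem⟩, k) : teeth M y × cantorSet)
    exact ⟨q k₀, q k₁, q k₂, OnePoint.coe_ne_infty _, OnePoint.coe_ne_infty _,
      OnePoint.coe_ne_infty _, fun h' => h1 (congrArg Prod.snd h').symm,
      fun h' => h2 (congrArg Prod.snd h').symm, fun h' => h2' (congrArg Prod.snd h').symm⟩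

theorem model_le_coe_iff (p q : teeth M y × cantorSet) :
    h.model.le (p : CombMultiple M y) q ↔
      (p.1 : ℝ × ℝ).1 = (q.1 : ℝ × ℝ).1 ∧ p.2 = q.2 ∧ (p.1 : ℝ × ℝ).2 ≤ (q.1 : ℝ × ℝ).2 := by
  constructor
  · rintro (h' | ⟨h1, h2⟩)
    · exact absurd h' (OnePoint.coe_ne_infty p)
    · exact ⟨congrArg (fun q => (q.1 : ℝ)) h1,
        congrArg (fun q : cantorSet × cantorSet => q.2) h1, h2⟩
  · rintro ⟨h1, h2, h3⟩
    exact Or.inr ⟨Prod.ext (Subtype.ext h1) h2, h3⟩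

/-- The endpoints of the Cantor multiple lie over tips of teeth. -/
theorem exists_of_mem_endpoints {x : CombMultiple M y} (hx : x ∈ endpoints (CombMultiple M y)) :
    ∃ p : teeth M y × cantorSet, x = p ∧ ((p.1 : ℝ × ℝ) = (0, 1) ∨ ∃ (k : ℕ) (n : Fin (k + 1) → ℕ+),
      (p.1 : ℝ × ℝ) = (toothPos n, toothHeight M y n)) := by
  have := h.metrizableSpace
  rw [FanModel.mem_endpoints_iff (D := h.model)] at hx
  induction x using OnePoint.rec with
  | infty => exact absurd rfl hx.1
  | coe p =>
    refine ⟨p, rfl, ?_⟩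
    obtain ⟨⟨⟨u, v⟩, hz⟩, c⟩ := p
    obtain ⟨hv, h' | ⟨k, n, h'⟩⟩ := mem_teeth.mp hz
    · left
      have h1 := hx.2 ((⟨(0, 1), base_mem⟩, c) : teeth M y × cantorSet)
        ((h.model_le_coe_iff _ _).mpr ⟨h'.1, rfl, h'.2⟩)
      exact congrArg (fun p => (p.1 : ℝ × ℝ)) (OnePoint.coe_injective h1).symm
    · right
      have h1 := hx.2 ((⟨_, h.tip_mem n⟩, c) : teeth M y × cantorSet)
        ((h.model_le_coe_iff _ _).mpr ⟨h'.1, rfl, h'.2⟩)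
      exact ⟨k, n, congrArg (fun p => (p.1 : ℝ × ℝ)) (OnePoint.coe_injective h1).symm⟩

theorem base_mem_endpoints (c : cantorSet) :
    (((⟨(0, 1), base_mem⟩, c) : teeth M y × cantorSet) : CombMultiple M y) ∈
      endpoints (CombMultiple M y) := by
  have := h.metrizableSpace
  rw [FanModel.mem_endpoints_iff (D := h.model)]
  refine ⟨OnePoint.coe_ne_infty _, fun x hx => ?_⟩
  refine (hx.eq_of_height ?_).symm
  induction x using OnePoint.rec with
  | infty => exact zero_le_one
  | coe p => exact h.snd_le_one p.1.2

omit h in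
theorem Movable.exists_homeomorph {p q : teeth M y × cantorSet} (hpq : Movable p q) :
    ∃ Φ : CombMultiple M y ≃ₜ CombMultiple M y, Φ p = q := by
  obtain ⟨Φ, rfl⟩ := hpq
  exact ⟨Φ.onePointCongr, rfl⟩

/-- Transport from the tip `(0, 1)`, which is maximal because its height is. This avoids showing
that distinct tuples have distinct positions. -/
theorem tip_mem_endpoints {k : ℕ} (n : Fin (k + 1) → ℕ+) (c : cantorSet) :
    (((⟨_, h.tip_mem n⟩, c) : teeth M y × cantorSet) : CombMultiple M y) ∈
      endpoints (CombMultiple M y) := by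
  obtain ⟨Φ, hΦ⟩ := (h.movable_tip n c c).exists_homeomorph
  rw [← hΦ]
  exact apply_mem_endpoints Φ (h.base_mem_endpoints c)

theorem isEndpointHomogeneous : IsEndpointHomogeneous (CombMultiple M y) := by
  let k₀ : cantorSet := ⟨0, zero_mem_cantorSet⟩
  have key : ∀ e ∈ endpoints (CombMultiple M y), ∃ p : teeth M y × cantorSet, e = p ∧
      Movable (⟨(0, 1), base_mem⟩, k₀) p := by
    intro e he
    obtain ⟨⟨⟨z, hz⟩, c⟩, rfl, rfl | ⟨k, n, rfl⟩⟩ := h.exists_of_mem_endpoints he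
    · exact ⟨_, rfl, movable_cantorSet _ _ _⟩
    · exact ⟨_, rfl, h.movable_tip n _ _⟩
  intro e he e' he'
  obtain ⟨p, rfl, hp⟩ := key e he
  obtain ⟨q, rfl, hq⟩ := key e' he'
  exact (hp.symm.trans hq).exists_homeomorph

end CombParam

namespace FanModel

variable {F Z : Type*} [TopologicalSpace F] [TopologicalSpace Z] {D : FanModel F Z}
variable [CompactSpace F] [T2Space F] [T2Space Z]

/-- A blade of height one is parametrized by height. -/
theorem isBladeTrace_of_height_eq_one {e : F} (he : D.height e = 1) {X : Set I}
    (hX : ∀ w, D.le w e → ∀ s : I, (s : ℝ) = D.height w →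
      (s ∈ X ↔ w ∈ closure (endpoints F \ D.seg D.top e))) :
    IsBladeTrace X D.top (D.seg D.top e) := by
  have himg := image_height_seg (D.top_le e)
  rw [height_top, he] at himg
  obtain ⟨ψ, hψ⟩ := exists_homeomorph_of_injOn (isClosed_seg D.top e).isCompact D.height
    D.continuous_height.continuousOn (injOn_height_seg _ _) himg
  refine ⟨ψ.symm, ?_, ?_⟩
  · rw [← D.height_eq_zero, ← hψ, ψ.apply_symm_apply]
    rfl
  · ext w
    constructor
    · rintro ⟨s, hs, rfl⟩
      refine ⟨(ψ.symm s).2, (hX _ (mem_seg_top.mp (ψ.symm s).2) s ?_).mp hs⟩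
      rw [← hψ, ψ.apply_symm_apply]
    · rintro ⟨hw, hw'⟩
      refine ⟨ψ ⟨w, hw⟩, (hX w (mem_seg_top.mp hw) _ (hψ ⟨w, hw⟩)).mpr hw', ?_⟩
      show ((ψ.symm (ψ ⟨w, hw⟩) : D.seg D.top e) : F) = w
      rw [ψ.symm_apply_apply]

end FanModel

/-! ### The trace of the endpoints on the blade over `0`. -/

namespace CombParam

variable {M : ℝ} {y : ℕ+ → I} (h : CombParam M y)
include h

/-- The lowest point of the Cantor set. -/
abbrev _root_.cantorZero : cantorSet := ⟨0, zero_mem_cantorSet⟩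

/-- The endpoint of the blade over the point `0` of the base and of the Cantor set. -/
noncomputable def baseTip (M : ℝ) (y : ℕ+ → I) : CombMultiple M y :=
  ((⟨(0, 1), base_mem⟩, cantorZero) : teeth M y × cantorSet)

theorem le_baseTip_iff (p : teeth M y × cantorSet) :
    h.model.le (p : CombMultiple M y) (baseTip M y) ↔
      (p.1 : ℝ × ℝ).1 = 0 ∧ p.2 = cantorZero := by
  rw [baseTip, h.model_le_coe_iff]
  exact ⟨fun h' => ⟨h'.1, h'.2.1⟩, fun h' => ⟨h'.1, h'.2, h.snd_le_one p.1.2⟩⟩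

/-- The other Cantor copies of the tip accumulate here, along the points `2·3^(-m)` of the Cantor
set. This puts `1` in the trace although all other teeth have height at most `M < 1`. -/
theorem baseTip_mem_closure :
    baseTip M y ∈ closure (endpoints (CombMultiple M y) \
      h.model.seg h.model.top (baseTip M y)) := by
  have hm : ∀ m : ℕ+, (1 / 3 : ℝ) ^ (m : ℕ) * (2 + 0) ∈ cantorSet :=
    fun m => mul_mem_cantorSet zero_mem_cantorSet m
  let u : ℕ+ → CombMultiple M y := fun m =>
    ((⟨(0, 1), base_mem⟩, ⟨_, hm m⟩) : teeth M y × cantorSet)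
  have hu : Tendsto u cofinite (𝓝 (baseTip M y)) := by
    refine (OnePoint.continuous_coe.tendsto _).comp (tendsto_const_nhds.prodMk_nhds ?_)
    rw [tendsto_subtype_rng]
    have := tendsto_third_pow.mul_const (2 + 0 : ℝ)
    rwa [zero_mul] at this
  refine mem_closure_of_tendsto hu (Eventually.of_forall fun m => ⟨h.base_mem_endpoints _, ?_⟩)
  intro hmem
  have h1 := ((h.le_baseTip_iff _).mp (FanModel.mem_seg_top.mp hmem)).2
  have h2 : (1 / 3 : ℝ) ^ (m : ℕ) * (2 + 0) = 0 := congrArg Subtype.val h1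
  have := third_pow_pos m
  linarith

/-- The value is repeated infinitely often, so infinitely many one-index teeth have exactly this
height, and their positions tend to `0`. -/
theorem mem_closure_of_mem_range (n : ℕ+) (hn : {m | y m = y n}.Infinite)
    (hmem : ((0, (y n : ℝ)) : ℝ × ℝ) ∈ teeth M y) :
    (((⟨(0, y n), hmem⟩, cantorZero) : teeth M y × cantorSet) : CombMultiple M y) ∈
      closure (endpoints (CombMultiple M y) \ h.model.seg h.model.top (baseTip M y)) := by
  let u : ℕ+ → CombMultiple M y := fun m =>
    ((⟨_, h.tip_mem (k := 0) fun _ => m⟩, cantorZero) : teeth M y × cantorSet)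
  have := hn.cofinite_inf_principal_neBot
  have hu : Tendsto u (cofinite ⊓ 𝓟 {m | y m = y n})
      (𝓝 ((⟨(0, y n), hmem⟩, cantorZero) : teeth M y × cantorSet)) := by
    refine (OnePoint.continuous_coe.tendsto _).comp (Tendsto.prodMk_nhds ?_ tendsto_const_nhds)
    rw [tendsto_subtype_rng]
    refine Tendsto.prodMk_nhds ?_ ?_
    · have := (tendsto_third_pow.mul_const (2 + 0 : ℝ)).mono_left
        (inf_le_left (b := 𝓟 {m | y m = y n}))
      rw [zero_mul] at this
      exact this.congr fun m => (toothPos_one _).symm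
    · refine tendsto_const_nhds.congr' ?_
      filter_upwards [mem_inf_of_right (mem_principal_self _)] with m hm
      have hm' : y m = y n := hm
      rw [toothHeight_one, hm']
  refine mem_closure_of_tendsto hu (Eventually.of_forall fun m => ⟨h.tip_mem_endpoints _ _, ?_⟩)
  intro hmem
  have h1 := ((h.le_baseTip_iff _).mp (FanModel.mem_seg_top.mp hmem)).1
  exact (toothPos_mem_Ioo fun _ : Fin 1 => m).1.ne' h1

/-- The tip `(0, 1)` and the one-index tips have heights in the closed set `X`. A longer tuple at
position below `3^(-N)` has first index above `N`, so its height is at most `M ^ N`. This is the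
purpose of the powers of `M` in the heights. -/
theorem notMem_closure_endpoints {X : Set I} (hX : IsClosed X) (hyX : ∀ n, y n ∈ X) (h1 : 1 ∈ X)
    (p : teeth M y × cantorSet) (hp : (p.1 : ℝ × ℝ).1 = 0)
    (hpX : (p.1 : ℝ × ℝ).2 ∉ ((↑) : I → ℝ) '' X) :
    (p : CombMultiple M y) ∉ closure (endpoints (CombMultiple M y)) := by
  obtain ⟨N, hN⟩ := exists_pow_lt_of_lt_one (mem_teeth.mp p.1.2).1 h.lt_one
  have hX' : IsClosed (((↑) : I → ℝ) '' X) := (hX.isCompact.image continuous_subtype_val).isClosed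
  let O : Set (teeth M y × cantorSet) := {q | (q.1 : ℝ × ℝ).1 < (1 / 3) ^ N ∧
    (q.1 : ℝ × ℝ).2 ∉ ((↑) : I → ℝ) '' X ∧ M ^ N < (q.1 : ℝ × ℝ).2}
  have hfst : Continuous fun q : teeth M y × cantorSet => (q.1 : ℝ × ℝ).1 := by fun_prop
  have hsnd : Continuous fun q : teeth M y × cantorSet => (q.1 : ℝ × ℝ).2 := by fun_prop
  have hO : IsOpen O := (isOpen_lt hfst continuous_const).inter
    ((hX'.isOpen_compl.preimage hsnd).inter (isOpen_lt continuous_const hsnd))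
  intro hcl
  obtain ⟨x, ⟨q, hq, rfl⟩, hx⟩ := mem_closure_iff.mp hcl _ (OnePoint.isOpen_image_coe.mpr hO)
    ⟨p, ⟨by rw [hp]; exact third_pow_pos N, hpX, hN⟩, rfl⟩
  obtain ⟨q', hqq', hq'⟩ := h.exists_of_mem_endpoints hx
  obtain rfl := OnePoint.coe_injective hqq'
  obtain ⟨hq1, hq2, hq3⟩ := hq
  rcases hq' with hq' | ⟨k, n, hq'⟩
  · rw [hq'] at hq2
    exact hq2 ⟨1, h1, rfl⟩
  rw [hq'] at hq1 hq2 hq3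
  cases k with
  | zero => exact hq2 ⟨y (n 0), hyX _, (toothHeight_one M y n).symm⟩
  | succ k =>
    rw [← Fin.cons_self_tail n] at hq1 hq3
    rw [toothHeight_cons] at hq3
    rw [toothPos_cons] at hq1
    simp only at hq1 hq3
    have hp1 := (toothPos_mem_Ioo (Fin.tail n)).1
    have h3 := third_pow_pos (n 0)
    have hlt : (1 / 3 : ℝ) ^ (n 0 : ℕ) < (1 / 3) ^ N := by nlinarith
    have hN0 : N < n 0 := (pow_lt_pow_iff_right_of_lt_one₀ (by norm_num) (by norm_num)).mp hlt
    have h4 : M ^ (n 0 : ℕ) ≤ M ^ N := pow_le_pow_of_le_one h.pos.le h.lt_one.le hN0.le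
    have h5 := h.toothHeight_mem_Ioc (Fin.tail n)
    have h6 : (y (n 0) : ℝ) * toothHeight M y (Fin.tail n) ≤ 1 :=
      mul_le_one₀ (y (n 0)).2.2 h5.1.le (h5.2.trans h.lt_one.le)
    have h7 : M ^ (n 0 : ℕ) * (y (n 0) * toothHeight M y (Fin.tail n)) ≤ M ^ (n 0 : ℕ) :=
      mul_le_of_le_one_right (pow_pos h.pos _).le h6
    rw [← mul_assoc] at h7
    linarith

/-- The trace of the closure of the set of endpoints on the base blade. -/
theorem isBladeTrace_baseTip {X : Set I} (hX : IsClosed X) (hyX : ∀ n, y n ∈ X) (h0 : 0 ∈ X)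
    (h1 : 1 ∈ X) (hXy : ∀ s ∈ X, s ≠ 1 → s ∈ closure (range y))
    (hy : ∀ n, {m | y m = y n}.Infinite) :
    IsBladeTrace X h.model.top (h.model.seg h.model.top (baseTip M y)) := by
  have := h.metrizableSpace
  have hheight : h.model.height (baseTip M y) = 1 := rfl
  refine FanModel.isBladeTrace_of_height_eq_one hheight fun w hw s hs => ?_
  constructor
  · intro hsX
    by_cases hs1 : s = 1
    · have : w = baseTip M y := hw.eq_of_height (by rw [hheight, ← hs, hs1]; rfl)
      rw [this]
      exact h.baseTip_mem_closure
    -- `γ` parametrizes the blade by height. Its continuity extends the statement from the values of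
    -- `y` to their closure.
    have hex : ∀ r : I, ∃ v, h.model.le v (baseTip M y) ∧ h.model.height v = r := fun r =>
      FanModel.exists_le_height r.2.1 (hheight ▸ r.2.2)
    choose γ hγ hγ' using hex
    have hcont : Continuous γ := by
      have himg := FanModel.image_height_seg (h.model.top_le (baseTip M y))
      rw [FanModel.height_top, hheight] at himg
      obtain ⟨ψ, hψ⟩ := exists_homeomorph_of_injOn
        (FanModel.isClosed_seg (D := h.model) h.model.top (baseTip M y)).isCompact h.model.height
        h.model.continuous_height.continuousOn (FanModel.injOn_height_seg _ _) himg
      have : γ = fun r => ((ψ.symm r : h.model.seg h.model.top (baseTip M y)) :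
          CombMultiple M y) := by
        funext r
        refine FanModel.injOn_height_seg (D := h.model) h.model.top (baseTip M y)
          (FanModel.mem_seg_top.mpr (hγ r)) (ψ.symm r).2 ?_
        rw [hγ', ← hψ, ψ.apply_symm_apply]
      rw [this]
      exact continuous_subtype_val.comp ψ.symm.continuous
    have hws : w = γ s := FanModel.injOn_height_seg (D := h.model) h.model.top (baseTip M y)
      (FanModel.mem_seg_top.mpr hw) (FanModel.mem_seg_top.mpr (hγ s)) (by rw [hγ', hs])
    rw [hws]
    refine closure_minimal ?_ (isClosed_closure.preimage hcont) (hXy s hsX hs1)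
    rintro _ ⟨n, rfl⟩
    have hmem : ((0, (y n : ℝ)) : ℝ × ℝ) ∈ teeth M y :=
      mem_teeth.mpr ⟨h.y_pos n, Or.inl ⟨rfl, (y n).2.2⟩⟩
    have h2 := h.mem_closure_of_mem_range n (hy n) hmem
    have h3 : γ (y n) = ((⟨(0, y n), hmem⟩, cantorZero) : teeth M y × cantorSet) :=
      FanModel.injOn_height_seg (D := h.model) h.model.top (baseTip M y)
        (FanModel.mem_seg_top.mpr (hγ _))
        (FanModel.mem_seg_top.mpr ((h.le_baseTip_iff _).mpr ⟨rfl, rfl⟩)) (hγ' _)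
    rw [mem_preimage, h3]
    exact h2
  · intro hwc
    by_contra hsX
    induction w using OnePoint.rec with
    | infty =>
      have : s = 0 := Subtype.ext hs
      exact hsX (this ▸ h0)
    | coe p =>
      refine h.notMem_closure_endpoints hX hyX h1 p ((h.le_baseTip_iff p).mp hw).1 ?_
        (closure_mono sdiff_subset hwc)
      rintro ⟨r, hr, hr'⟩
      have : s = r := Subtype.ext (hs.trans hr'.symm)
      exact hsX (this ▸ hr)

end CombParam

/-! ## The two descriptions of the Cantor multiple -/

/-- Removing the point at infinity from a one-point compactification. -/
noncomputable def neInftyHomeomorph (T : Type*) [TopologicalSpace T] :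
    {x : OnePoint T // x ≠ OnePoint.infty} ≃ₜ T :=
  ((OnePoint.isOpenEmbedding_coe (X := T)).isEmbedding.toHomeomorph.trans
    (Homeomorph.setCongr (OnePoint.compl_infty (X := T)).symm)).symm

/-- The Cantor multiple of the fan of a comb is a one-point compactification of the product of the
comb, without its base, with the Cantor set. -/
noncomputable def combMultipleHomeomorph (M : ℝ) (y : ℕ+ → I) :
    CantorMultiple (CombFan (comb M y)) OnePoint.infty ≃ₜ CombMultiple M y :=
  ((neInftyHomeomorph _).prodCongr (Homeomorph.refl cantorSet)).onePointCongr

theorem CombParam.cantorMultiple {M : ℝ} {y : ℕ+ → I} (h : CombParam M y) {X : Set I}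
    (hX : IsClosed X) (hyX : ∀ n, y n ∈ X) (h0 : 0 ∈ X) (h1 : 1 ∈ X)
    (hXy : ∀ s ∈ X, s ≠ 1 → s ∈ closure (range y)) (hy : ∀ n, {m | y m = y n}.Infinite) :
    IsSmoothFan (CantorMultiple (CombFan (comb M y)) OnePoint.infty) ∧
    IsEndpointHomogeneous (CantorMultiple (CombFan (comb M y)) OnePoint.infty) ∧
    ∀ Y : Set I, IsEPG (CantorMultiple (CombFan (comb M y)) OnePoint.infty) Y ↔
      EquivalentlyEmbedded X Y := by
  have := h.metrizableSpace
  let e := combMultipleHomeomorph M y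
  have := e.isEmbedding.metrizableSpace
  have hs := (h.model.congr e).isSmoothFan
  refine ⟨hs, h.isEndpointHomogeneous.congr e.symm, fun Y => ?_⟩
  have hbase := h.base_mem_endpoints cantorZero
  have hE : IsEPG (CombMultiple M y) X := FanModel.isEPG_of_isBladeTrace (D := h.model)
    h.isEndpointHomogeneous hbase (h.isBladeTrace_baseTip hX hyX h0 h1 hXy hy)
  have hramif : IsRamificationPoint h.model.top := FanModel.isRamificationPoint_top
  exact isEPG_iff_of_isEPG (hE.congr hs.1 e.symm) (hramif.image e.symm)
    ⟨_, image_mem_blades ⟨_, hbase, h.model.isSegment_seg_top _⟩ e.symm⟩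

/-! ## The sets `X_A` -/

/-- The point `1 / n` of the unit interval. -/
noncomputable def unitFrac (n : ℕ+) : I :=
  ⟨1 / (n : ℝ), by positivity, by
    rw [div_le_one (by exact_mod_cast n.pos)]
    exact_mod_cast (one_le : 1 ≤ n)⟩

theorem unitFrac_strictAnti : StrictAnti unitFrac := fun m n hmn =>
  one_div_lt_one_div_of_lt (by exact_mod_cast m.pos) (by exact_mod_cast hmn : (m : ℝ) < n)

theorem one_div_le_of_lt {m n : ℕ+} (hmn : m < n) : 1 / (n : ℝ) ≤ 1 / ((m : ℝ) + 1) := by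
  refine one_div_le_one_div_of_le (by positivity) ?_
  exact_mod_cast PNat.add_one_le_iff.mpr hmn

theorem tendsto_unitFrac : Tendsto unitFrac cofinite (𝓝 0) := by
  rw [tendsto_subtype_rng]
  have h1 : Tendsto (fun n : ℕ => 1 / (n : ℝ)) cofinite (𝓝 0) := by
    rw [Nat.cofinite_eq_atTop]
    exact tendsto_one_div_atTop_nhds_zero_nat
  exact h1.comp PNat.coe_injective.tendsto_cofinite

/-- The endpoints `a n < b n` lie strictly between `1 / (n + 1)` and `1 / n`. -/
def IsGapFamily (a b : ℕ+ → ℝ) : Prop :=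
  ∀ n : ℕ+, 1 / ((n : ℝ) + 1) < a n ∧ a n < b n ∧ b n < 1 / (n : ℝ)

theorem exists_isGapFamily : ∃ a b : ℕ+ → ℝ, IsGapFamily a b := by
  have key : ∀ n : ℕ+, ∃ p : ℝ × ℝ, 1 / ((n : ℝ) + 1) < p.1 ∧ p.1 < p.2 ∧ p.2 < 1 / (n : ℝ) := by
    intro n
    have hn : (0 : ℝ) < n := by exact_mod_cast n.pos
    obtain ⟨u, hu, hu'⟩ := exists_between (one_div_lt_one_div_of_lt hn (lt_add_one (n : ℝ)))
    obtain ⟨v, hv, hv'⟩ := exists_between hu'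
    exact ⟨(u, v), hu, hv, hv'⟩
  choose p hp using key
  exact ⟨fun n => (p n).1, fun n => (p n).2, hp⟩

/-- The isolated points of a set. -/
def isolatedPoints {T : Type*} [TopologicalSpace T] (X : Set T) : Set T :=
  {s | s ∈ X ∧ s ∉ closure (X \ {s})}

theorem image_isolatedPoints {T : Type*} [TopologicalSpace T] (h : T ≃ₜ T) (X : Set T) :
    h '' isolatedPoints X = isolatedPoints (h '' X) := by
  ext t
  obtain ⟨s, rfl⟩ := h.surjective t
  simp only [isolatedPoints, h.injective.mem_set_image, mem_ofPred_eq]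
  rw [← image_singleton, ← image_sdiff h.injective, ← h.image_closure, h.injective.mem_set_image]

namespace IsGapFamily

variable {a b : ℕ+ → ℝ} {A : Set ℕ+}

theorem mem_setX_iff {s : I} : s ∈ setX a b A ↔
    s = 0 ∨ (∃ n, s = unitFrac n) ∨ ∃ n ∈ A, (s : ℝ) ∈ Icc (a n) (b n) := by
  simp only [setX, mem_ofPred_eq, Subtype.ext_iff, unitFrac]
  rfl

theorem unitFrac_mem (n : ℕ+) : unitFrac n ∈ setX a b A := mem_setX_iff.mpr (Or.inr (Or.inl ⟨n, rfl⟩))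

theorem zero_mem : (0 : I) ∈ setX a b A := mem_setX_iff.mpr (Or.inl rfl)

theorem unitFrac_one : unitFrac 1 = 1 := Subtype.ext (by simp [unitFrac])

theorem one_mem : (1 : I) ∈ setX a b A := unitFrac_one ▸ unitFrac_mem 1

variable (h : IsGapFamily a b)
include h

theorem a_pos (n : ℕ+) : 0 < a n := lt_trans (by positivity) (h n).1

theorem b_lt_a {m n : ℕ+} (hmn : m < n) : b n < a m :=
  ((h n).2.2.trans_le (one_div_le_of_lt hmn)).trans (h m).1

/-- The pieces of index `n` lie below `1/n`, so away from `0` only finitely many closed pieces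
occur. -/
theorem isClosed_setX : IsClosed (setX a b A) := by
  let K : ℕ+ → Set I := fun n => {unitFrac n} ∪ {s | n ∈ A ∧ (s : ℝ) ∈ Icc (a n) (b n)}
  have hK : ∀ n, IsClosed (K n) := fun n => isClosed_singleton.union
    (isClosed_const.inter (isClosed_Icc.preimage continuous_subtype_val))
  have hKle : ∀ n, ∀ s ∈ K n, s ≤ unitFrac n := by
    rintro n s (rfl | hs)
    · exact le_rfl
    · exact hs.2.2.trans (h n).2.2.le
  have heq : setX a b A = {0} ∪ ⋃ n, K n := by
    ext s
    simp only [mem_setX_iff, mem_union, mem_singleton_iff, mem_iUnion, K, mem_ofPred_eq, exists_or]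
  refine isClosed_of_closure_subset fun s hs => ?_
  rw [heq] at hs ⊢
  by_cases hs0 : s = 0
  · exact Or.inl hs0
  obtain ⟨u, hu0, hus⟩ := exists_between (unitInterval.pos_iff_ne_zero.mpr hs0)
  have hfin : {n | ¬unitFrac n < u}.Finite := tendsto_unitFrac (Iio_mem_nhds hu0)
  have h2 : IsClosed (⋃ n ∈ {n | ¬unitFrac n < u}, K n) := hfin.isClosed_biUnion fun n _ => hK n
  have h3 := closure_minimal (s := Ioi u ∩ ({0} ∪ ⋃ n, K n)) ?_ h2
    (isOpen_Ioi.inter_closure ⟨hus, hs⟩)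
  · obtain ⟨n, -, hn⟩ := mem_iUnion₂.mp h3
    exact Or.inr (mem_iUnion.mpr ⟨n, hn⟩)
  · rintro w ⟨hw, rfl | hw'⟩
    · exact absurd hu0 (not_lt.mpr (show u ≤ 0 from (show u < 0 from hw).le))
    · obtain ⟨n, hn⟩ := mem_iUnion.mp hw'
      refine mem_iUnion₂.mpr ⟨n, ?_, hn⟩
      exact not_lt.mpr ((show u < w from hw).le.trans (hKle n w hn))

omit h in
theorem zero_mem_closure {X : Set I} (hX : ∀ n : ℕ+, n ≠ 1 → unitFrac n ∈ X) :
    (0 : I) ∈ closure X := by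
  refine mem_closure_of_tendsto tendsto_unitFrac ?_
  filter_upwards [(finite_singleton (1 : ℕ+)).compl_mem_cofinite] with n hn
  exact hX n hn

/-- The point `1/n` has a gap down to `b n` and, for `n > 1`, a gap above it before `a (n - 1)`. The
intervals are nondegenerate, hence without isolated points, and `0` is the limit of the `1/n`. -/
theorem isolatedPoints_setX : isolatedPoints (setX a b A) = range unitFrac := by
  ext s
  constructor
  · rintro ⟨hs, hs'⟩
    rcases mem_setX_iff.mp hs with rfl | ⟨n, rfl⟩ | ⟨n, hn, hsn⟩
    · refine absurd (zero_mem_closure fun n _ => ?_) hs'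
      refine ⟨unitFrac_mem n, fun h0 => ?_⟩
      have h1 : (1 / (n : ℝ)) = 0 := congrArg Subtype.val h0
      exact (one_div_pos.mpr (by exact_mod_cast n.pos : (0 : ℝ) < n)).ne' h1
    · exact mem_range_self n
    · exfalso
      have hlt1 : b n < 1 := (h n).2.2.trans_le (unitFrac n).2.2
      let α : I := ⟨a n, (h.a_pos n).le, ((h n).2.1.trans hlt1).le⟩
      let β : I := ⟨b n, ((h.a_pos n).trans (h n).2.1).le, hlt1.le⟩
      have hαβ : α < β := (h n).2.1
      have hnt : (Icc α β).Nontrivial := ⟨α, ⟨_root_.le_refl α, hαβ.le⟩, β,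
        ⟨hαβ.le, _root_.le_refl β⟩, hαβ.ne⟩
      have hpp := IsPreconnected.preperfect_of_nontrivial hnt isPreconnected_Icc
      have hacc := accPt_iff_clusterPt.mp (hpp s ⟨hsn.1, hsn.2⟩)
      refine hs' ?_
      rw [mem_closure_iff_clusterPt]
      refine hacc.mono ?_
      rw [inf_principal]
      refine principal_mono.mpr ?_
      rintro r ⟨hr, hr'⟩
      exact ⟨mem_setX_iff.mpr (Or.inr (Or.inr ⟨n, hn, hr'.1, hr'.2⟩)), hr⟩
  · rintro ⟨n, rfl⟩
    refine ⟨unitFrac_mem n, fun hcl => ?_⟩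
    have hfin : {m : ℕ+ | m < n}.Finite := Set.finite_Iio n
    have hO : IsOpen ({r : I | b n < r} ∩ ⋂ m ∈ {m : ℕ+ | m < n}, {r : I | (r : ℝ) < a m}) :=
      (isOpen_lt continuous_const continuous_subtype_val).inter
        (hfin.isOpen_biInter fun m _ => isOpen_lt continuous_subtype_val continuous_const)
    obtain ⟨r, ⟨hr1, hr2⟩, hr3, hr4⟩ := mem_closure_iff.mp hcl _ hO ⟨(h n).2.2,
      mem_iInter₂.mpr fun m hm => (one_div_le_of_lt hm).trans_lt (h m).1⟩
    have hr1' : b n < r := hr1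
    have hr2' : ∀ m, m < n → (r : ℝ) < a m := fun m hm => mem_iInter₂.mp hr2 m hm
    have hbn := (h.a_pos n).trans (h n).2.1
    rcases mem_setX_iff.mp hr3 with rfl | ⟨m, rfl⟩ | ⟨m, -, hm, hm'⟩
    · exact absurd hr1' (not_lt.mpr hbn.le)
    · rcases lt_trichotomy m n with hlt | rfl | hlt
      · exact absurd (hr2' m hlt) (not_lt.mpr ((h m).2.1.trans (h m).2.2).le)
      · exact hr4 rfl
      · exact absurd hr1' (not_lt.mpr ((one_div_le_of_lt hlt).trans
          ((h n).1.trans (h n).2.1).le))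
    · rcases lt_trichotomy m n with hlt | rfl | hlt
      · exact absurd (hr2' m hlt) (not_lt.mpr hm)
      · exact absurd hr1' (not_lt.mpr hm')
      · exact absurd hr1' (not_lt.mpr (hm'.trans ((h.b_lt_a hlt).trans (h n).2.1).le))

omit h in
theorem _root_.PNat.apply_eq_of_strictMono_of_surjective {k : ℕ+ → ℕ+} (hk : StrictMono k)
    (hs : Function.Surjective k) (n : ℕ+) : k n = n := by
  obtain ⟨l, hl⟩ := hs.hasRightInverse
  have hlm : StrictMono l := fun i j hij => hk.lt_iff_lt.mp (by rwa [hl i, hl j])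
  refine le_antisymm ?_ hk.le_apply
  calc k n ≤ k (l n) := hk.monotone hlm.le_apply
    _ = n := hl n

/-- The homeomorphism permutes the isolated points `1/n` monotonically, and such a permutation is
trivial. It therefore preserves the gap between `1/(n+1)` and `1/n`, and the image of `a n` is a
point of `X_{A'}` in that gap, which forces `n ∈ A'`. -/
theorem subset_of_equivalentlyEmbedded {A' : Set ℕ+}
    (hE : EquivalentlyEmbedded (setX a b A) (setX a b A')) : A ⊆ A' := by
  obtain ⟨g, hg, hgX⟩ := hE
  have hR : g '' range unitFrac = range unitFrac := by
    rw [← h.isolatedPoints_setX (A := A), image_isolatedPoints, hgX, h.isolatedPoints_setX,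
      h.isolatedPoints_setX]
  have hk : ∀ n, ∃ m, unitFrac m = g (unitFrac n) := fun n =>
    hR.subset (mem_image_of_mem g (mem_range_self n))
  choose k hk using hk
  have hkm : StrictMono k := fun m n hmn => by
    have h1 := hg (unitFrac_strictAnti hmn)
    rw [← hk, ← hk] at h1
    exact unitFrac_strictAnti.lt_iff_gt.mp h1
  have hks : Function.Surjective k := by
    intro m
    obtain ⟨_, ⟨n, rfl⟩, hn⟩ := hR.superset (mem_range_self m)
    exact ⟨n, unitFrac_strictAnti.injective ((hk n).trans hn)⟩
  have hfix : ∀ n, g (unitFrac n) = unitFrac n := fun n => by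
    rw [← hk, PNat.apply_eq_of_strictMono_of_surjective hkm hks]
  intro n hn
  have hlt1 : b n < 1 := (h n).2.2.trans_le (unitFrac n).2.2
  let α : I := ⟨a n, (h.a_pos n).le, ((h n).2.1.trans hlt1).le⟩
  have hα : α ∈ setX a b A := mem_setX_iff.mpr (Or.inr (Or.inr ⟨n, hn, le_rfl, (h n).2.1.le⟩))
  have h1 : g α < unitFrac n := by
    rw [← hfix]
    exact hg (show α < unitFrac n from (h n).2.1.trans (h n).2.2)
  have h2 : unitFrac (n + 1) < g α := by
    rw [← hfix]
    refine hg (show (1 / ((n + 1 : ℕ+) : ℝ)) < a n from ?_)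
    have := (h n).1
    rwa [PNat.add_coe, PNat.one_coe, Nat.cast_add, Nat.cast_one]
  rcases mem_setX_iff.mp (hgX.subset (mem_image_of_mem g hα)) with h0 | ⟨m, hm⟩ | ⟨m, hm, hm1, hm2⟩
  · rw [h0] at h2
    exact absurd h2 (not_lt.mpr (unitFrac (n + 1)).2.1)
  · rw [hm] at h1 h2
    have h3 := unitFrac_strictAnti.lt_iff_gt.mp h1
    have h4 := unitFrac_strictAnti.lt_iff_gt.mp h2
    exact absurd (PNat.lt_add_one_iff.mp h4) (not_le.mpr h3)
  · have h1' : ((g α : I) : ℝ) < 1 / (n : ℝ) := h1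
    have h2' : 1 / ((n : ℝ) + 1) < ((g α : I) : ℝ) := by
      have : 1 / ((n + 1 : ℕ+) : ℝ) < ((g α : I) : ℝ) := h2
      rwa [PNat.add_coe, PNat.one_coe, Nat.cast_add, Nat.cast_one] at this
    rcases lt_trichotomy m n with hlt | rfl | hlt
    · linarith [one_div_le_of_lt hlt, (h m).1]
    · exact hm
    · linarith [one_div_le_of_lt hlt, (h m).2.2]

omit h in
theorem _root_.EquivalentlyEmbedded.symm {X Y : Set I} (hE : EquivalentlyEmbedded X Y) :
    EquivalentlyEmbedded Y X := by
  obtain ⟨g, hg, rfl⟩ := hE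
  refine ⟨g.symm, fun s t hst => hg.lt_iff_lt.mp (by simpa using hst), ?_⟩
  rw [← image_comp, g.symm_comp_self, image_id]

theorem eq_of_equivalentlyEmbedded {A' : Set ℕ+}
    (hE : EquivalentlyEmbedded (setX a b A) (setX a b A')) : A = A' :=
  (h.subset_of_equivalentlyEmbedded hE).antisymm (h.subset_of_equivalentlyEmbedded hE.symm)

omit h in
theorem unitFrac_ne_one {n : ℕ+} (hn : n ≠ 1) : unitFrac n ≠ 1 := fun h' =>
  hn (unitFrac_strictAnti.injective (h'.trans unitFrac_one.symm))

omit h in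
theorem unitFrac_ne_zero (n : ℕ+) : unitFrac n ≠ 0 := fun h0 =>
  (one_div_pos.mpr (by exact_mod_cast n.pos : (0 : ℝ) < n)).ne' (congrArg Subtype.val h0)

-- A dense sequence `d` is read through the pairing function: `d i` occurs at the code of every pair
-- `(i, j)`.
omit h in
theorem exists_isCombSequence {Y : Set I} (hY : (Y \ {0}).Nonempty) :
    ∃ y : ℕ+ → I, IsCombSequence Y y := by
  have : Nonempty ↥(Y \ {0}) := hY.to_subtype
  let d := denseSeq ↥(Y \ {0})
  have hd : DenseRange d := denseRange_denseSeq _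
  refine ⟨fun n => d (Nat.unpair n.natPred).1, fun n => (d _).2, fun s hs => ?_, fun n => ?_⟩
  · have h1 : (s : I) ∈ Subtype.val '' closure (range d) := ⟨⟨s, hs⟩, hd _, rfl⟩
    refine closure_mono ?_ (image_closure_subset_closure_image continuous_subtype_val h1)
    rintro _ ⟨_, ⟨i, rfl⟩, rfl⟩
    exact ⟨(Nat.pair i 0).succPNat, by simp⟩
  · refine Set.infinite_of_injective_forall_mem
      (f := fun j : ℕ => (Nat.pair (Nat.unpair n.natPred).1 j).succPNat) (fun i j hij => ?_)
      fun j => by simp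
    have h1 := Nat.succPNat_injective hij
    have h2 := congrArg Nat.unpair h1
    rw [Nat.unpair_pair, Nat.unpair_pair] at h2
    exact congrArg Prod.snd h2

/-- The bound `b 1` serves whether or not `1 ∈ A`; it gives `M < 1`. -/
theorem le_of_mem_diff {s : I} (hs : s ∈ setX a b A \ {1}) : (s : ℝ) ≤ b 1 := by
  have h0 := (h.a_pos 1).trans (h 1).2.1
  have hle : ∀ n : ℕ+, n ≠ 1 → 1 / (n : ℝ) ≤ b 1 := by
    intro n hn
    have h1 : (1 : ℕ+) < n := lt_of_le_of_ne one_le hn.symm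
    exact (one_div_le_of_lt h1).trans ((h 1).1.trans (h 1).2.1).le
  rcases mem_setX_iff.mp hs.1 with rfl | ⟨n, rfl⟩ | ⟨n, -, -, hn⟩
  · exact h0.le
  · exact hle n fun hn => hs.2 (hn ▸ unitFrac_one)
  · by_cases hn1 : n = 1
    · exact hn1 ▸ hn
    · exact hn.trans ((h n).2.2.le.trans (hle n hn1))

theorem combParam {y : ℕ+ → I} (hy : IsCombSequence (setX a b A \ {1}) y) :
    CombParam (sSup ((fun s : I => (s : ℝ)) '' (setX a b A \ {1}))) y := by
  have hbdd : ∀ r ∈ (fun s : I => (s : ℝ)) '' (setX a b A \ {1}), r ≤ b 1 := by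
    rintro _ ⟨s, hs, rfl⟩
    exact h.le_of_mem_diff hs
  have hle : ∀ s ∈ setX a b A \ {1}, (s : ℝ) ≤ sSup ((fun s : I => (s : ℝ)) '' (setX a b A \ {1})) :=
    fun s hs => le_csSup ⟨b 1, hbdd⟩ (mem_image_of_mem _ hs)
  have hpos : ∀ n, 0 < (y n : ℝ) := fun n => unitInterval.pos_iff_ne_zero.mpr (hy.1 n).2
  refine ⟨(hpos 1).trans_le (hle _ (hy.1 1).1), ?_, hpos, fun n => hle _ (hy.1 n).1⟩
  refine (csSup_le ⟨_, mem_image_of_mem _ (hy.1 1).1⟩ hbdd).trans_lt ?_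
  exact (h 1).2.2.trans_le (by simp)

theorem fanOf {y : ℕ+ → I} (hy : IsCombSequence (setX a b A \ {1}) y) :
    IsSmoothFan (FanOf (setX a b A) y) ∧ IsEndpointHomogeneous (FanOf (setX a b A) y) ∧
      ∀ X : Set I, IsEPG (FanOf (setX a b A) y) X ↔ EquivalentlyEmbedded (setX a b A) X := by
  refine (h.combParam hy).cantorMultiple h.isClosed_setX (fun n => (hy.1 n).1.1) zero_mem one_mem
    (fun s hs hs1 => ?_) hy.2.2
  -- Density of `y` is only assumed away from `0`; the point `0` is recovered as the limit of the
  -- `1/n`.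
  by_cases hs0 : s = 0
  · rw [hs0, ← isClosed_closure.closure_eq]
    exact zero_mem_closure fun n hn => hy.2.1
      ⟨⟨unitFrac_mem n, unitFrac_ne_one hn⟩, unitFrac_ne_zero n⟩
  · exact hy.2.1 ⟨⟨hs, hs1⟩, hs0⟩

theorem isEmpty_homeomorph {A' : Set ℕ+} {y y' : ℕ+ → I}
    (hy : IsCombSequence (setX a b A \ {1}) y) (hy' : IsCombSequence (setX a b A' \ {1}) y')
    (hA : A ≠ A') : IsEmpty (FanOf (setX a b A) y ≃ₜ FanOf (setX a b A') y') := by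
  refine ⟨fun e => hA (h.eq_of_equivalentlyEmbedded ?_).symm⟩
  have refl : EquivalentlyEmbedded (setX a b A) (setX a b A) :=
    ⟨Homeomorph.refl _, strictMono_id, image_id _⟩
  exact ((h.fanOf hy').2.2 _).mp ((((h.fanOf hy).2.2 _).mpr refl).congr (h.fanOf hy').1.1 e)

omit h in
theorem exists_isCombSequence_setX (a b : ℕ+ → ℝ) (A : Set ℕ+) :
    ∃ y : ℕ+ → I, IsCombSequence (setX a b A \ {1}) y :=
  exists_isCombSequence ⟨unitFrac 2, ⟨unitFrac_mem 2, unitFrac_ne_one (by decide)⟩,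
    unitFrac_ne_zero 2⟩

end IsGapFamily

/-! ### The main theorem. -/

theorem uncountable_homeomorphismTypes : Uncountable (Quotient homeomorphismSetoid) := by
  obtain ⟨a, b, h⟩ := exists_isGapFamily
  choose y hy using fun A => IsGapFamily.exists_isCombSequence_setX a b A
  let f : Set ℕ+ → Quotient homeomorphismSetoid := fun A => Quotient.mk _
    ⟨TopCat.of (FanOf (setX a b A) (y A)), (h.fanOf (hy A)).1, (h.fanOf (hy A)).2.1⟩
  have hf : Function.Injective f := by
    intro A A' hAA'
    by_contra hne
    obtain ⟨e⟩ := Quotient.exact hAA'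
    exact (h.isEmpty_homeomorph (hy A) (hy A') hne).false e
  have : Uncountable (Set ℕ+) := by
    refine ⟨fun hc => ?_⟩
    obtain ⟨g, hg⟩ := hc.exists_injective_nat
    exact Function.cantor_injective (fun A => Nat.succPNat (g A))
      (Nat.succPNat_injective.comp hg)
  exact hf.uncountable

theorem mainTheorem2 :
    Uncountable (Quotient homeomorphismSetoid) ∧
    ∀ a b : ℕ+ → ℝ,
      (∀ n : ℕ+, 1 / ((n : ℝ) + 1) < a n ∧ a n < b n ∧ b n < 1 / (n : ℝ)) →
      (∀ A A' : Set ℕ+, A ≠ A' → ¬ EquivalentlyEmbedded (setX a b A) (setX a b A')) ∧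
      (∀ A : Set ℕ+, ∃ y : ℕ+ → I, IsCombSequence (setX a b A \ {1}) y) ∧
      (∀ (A : Set ℕ+) (y : ℕ+ → I), IsCombSequence (setX a b A \ {1}) y →
        IsSmoothFan (FanOf (setX a b A) y) ∧
        IsEndpointHomogeneous (FanOf (setX a b A) y) ∧
        ∀ X : Set I, IsEPG (FanOf (setX a b A) y) X ↔ EquivalentlyEmbedded (setX a b A) X) ∧
      (∀ (A A' : Set ℕ+) (y y' : ℕ+ → I), IsCombSequence (setX a b A \ {1}) y →
        IsCombSequence (setX a b A' \ {1}) y' → A ≠ A' →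
        IsEmpty (FanOf (setX a b A) y ≃ₜ FanOf (setX a b A') y')) := by
  refine ⟨uncountable_homeomorphismTypes, fun a b hab => ?_⟩
  have h : IsGapFamily a b := hab
  exact ⟨fun A A' hA hE => hA (h.eq_of_equivalentlyEmbedded hE),
    IsGapFamily.exists_isCombSequence_setX a b, fun A y hy => h.fanOf hy,
    fun A A' y y' hy hy' hA => h.isEmpty_homeomorph hy hy' hA⟩
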